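/- Let $n\ge 3$, let $U\subseteq\mathbb{R}^n$ be a connected open set (a chart domain), let $g$ and $\tilde g=\Omega^2 g$ be smooth pseudo-Riemannian metrics on $U$, both of constant sectional curvature, with $\Omega$ smooth and nowhere zero. A *non-degenerate second-order conformally superintegrable system* on $(U,g)$ consists of Hamiltonians $H=g^{ij}p_ip_j+V$, where $V$ runs through the linear span of $n+2$ linearly independent smooth functions that satisfy one Wilczynski equation $$V_{,ij}=T_{ij}{}^{m}V_{,m}+\tfrac1n g_{ij}\Delta V+\tau_{ij}V ,$$ with $T$ and $\tau$ smooth, symmetric and $g$-trace-free in $i,j$ (the *structure tensors*), together with linearly independent trace-free symmetric tensors $K^{(\alpha)\,ij}$ such that for every such $V$ there are functions $W^{(\alpha)}$ with $\{K^{(\alpha)\,ij}p_ip_j+W^{(\alpha)},H\}=\rho^{(\alpha)\,i}p_i\,H$; including $H$ itself there are at least $2n-1$ integrals (abundant systems have $\tfrac12n(n+1)$ of them; properly superintegrable systems are the case $\tau=0$). Two such systems on $(U,g)$ and $(U,\tilde g)$ are *conformally equivalent* with rescaling $\Omega$ ($\tilde H=\Omega^{-2}H$; this includes Stäckel equivalence)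 if the potentials of the second span the same space as the functions $\Omega^{-2}V$ and the tensors $\tilde K^{(\alpha)\,ij}$ span the same space as the $K^{(\alpha)\,ij}$. For a smooth function $B$ let $\mathcal S_g(B)_{ijk}$ be the totally symmetric, totally $g$-trace-free part of $\nabla^3B$ (so $\mathcal S_g(B)_{ijk}=\tfrac16\,(\text{sum of }B_{,ijk}\text{ over the permutations of }i,j,k)_\circ$), and put $$\bar t_g(B)=\tfrac{1}{n+2}\Bigl(\Delta B+\tfrac{2(n+1)}{n(n-1)}RB\Bigr),$$ $R$ being the scalar curvature. Call $(B,\bar t)$ a *pair of structure functions* of $T$ if $$T_{ijk}=\mathcal S_g(B)_{ijk}+g_{ik}\bar t_{,j}+g_{jk}\bar t_{,i}-\tfrac2n g_{ij}\bar t_{,k},$$ and call $B$ a *structure function* of $T$ if $$T_{ijk}=\mathcal S_g(B)_{ijk}+g_{ik}X_{j}+g_{jk}X_{i}-\tfrac2n g_{ij}X_{k},\qquad X_j=\tfrac1{n+2}\Bigl((\Delta B)_{,j}+\tfrac{2(n+1)}{n(n-1)}R\,B_{,j}\Bigr).$$ Call $q$ a *gauge function* for $g$ if $\mathcal S_g(q)=0$.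 **Theorem.** Given two such conformally equivalent systems on $(U,g)$ and $(U,\tilde g)$, with structure tensors $T$ and $\tilde T$, the structure functions transform by $B\mapsto\Omega^2B$, $\bar t\mapsto\bar t-3\ln|\Omega|$, up to gauge: 1. For all smooth $B,\bar t$: $(B,\bar t)$ is a pair of structure functions of $T$ (with respect to $g$) if and only if $(\Omega^2B,\ \bar t-3\ln|\Omega|)$ is a pair of structure functions of $\tilde T$ (with respect to $\tilde g$). 2. If $(B,\bar t)$ and $(\tilde B,\tilde t)$ are smooth pairs of structure functions of $T$ and of $\tilde T$, then $\tilde B-\Omega^2B$ is a gauge function for $\tilde g$ and $\tilde t=\bar t-3\ln|\Omega|+\text{const}$. 3. In particular, if a smooth $B$ is a structure function of $T$, then $(\Omega^2B,\ \bar t_g(B)-3\ln|\Omega|)$ is a pair of structure functions of $\tilde T$; and every smooth structure function $\tilde B$ of $\tilde T$ equals $\Omega^2B$ up to a gauge function for $\tilde g$, with $\bar t_{\tilde g}(\tilde B)=\bar t_g(B)-3\ln|\Omega|+\text{const}$. -/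

import Mathlib

open scoped ContDiff

noncomputable section

namespace Superintegrable

/-- Coordinate space. Everything below lives on an open subset `U` of it (the domain of a chart). -/
abbrev Coord (n : ℕ) : Type := Fin n → ℝ

/-- The coordinate derivative `∂ᵢ f` at `x`. -/
def pd {n : ℕ} (i : Fin n) (f : Coord n → ℝ) (x : Coord n) : ℝ :=
  fderiv ℝ f x (Pi.single i 1)

/-! ### Pseudo-Riemannian geometry in coordinates -/

/-- `g` is a smooth pseudo-Riemannian metric `gᵢⱼ` on `U`. -/
structure IsMetric {n : ℕ} (U : Set (Coord n)) (g : Coord n → Matrix (Fin n) (Fin n) ℝ) :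
    Prop where
  smooth : ∀ i j, ContDiffOn ℝ ∞ (fun x => g x i j) U
  symm : ∀ x ∈ U, ∀ i j, g x i j = g x j i
  nondegenerate : ∀ x ∈ U, (g x).det ≠ 0

/-- Christoffel symbols: `christoffel g k i j x` is `Γᵏᵢⱼ` at `x`. -/
def christoffel {n : ℕ} (g : Coord n → Matrix (Fin n) (Fin n) ℝ) (k i j : Fin n)
    (x : Coord n) : ℝ :=
  (1 / 2) * ∑ l, (g x)⁻¹ k l *
    (pd i (fun y => g y j l) x + pd j (fun y => g y i l) x - pd l (fun y => g y i j) x)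

/-- Riemann curvature: `riemann g l k i j x` is the component `Rˡₖᵢⱼ` determined by
`R(∂ᵢ, ∂ⱼ) ∂ₖ = Rˡₖᵢⱼ ∂ₗ`, with `R(X, Y) = [∇_X, ∇_Y] - ∇_[X,Y]`. -/
def riemann {n : ℕ} (g : Coord n → Matrix (Fin n) (Fin n) ℝ) (l k i j : Fin n)
    (x : Coord n) : ℝ :=
  pd i (christoffel g l j k) x - pd j (christoffel g l i k) x
    + ∑ m, (christoffel g l i m x * christoffel g m j k x
        - christoffel g l j m x * christoffel g m i k x)

/-- Ricci curvature `Rₖⱼ = Rⁱₖᵢⱼ`. -/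
def ricci {n : ℕ} (g : Coord n → Matrix (Fin n) (Fin n) ℝ) (k j : Fin n) (x : Coord n) : ℝ :=
  ∑ i, riemann g i k i j x

/-- Scalar curvature `R`; it equals `n (n - 1)` for the unit sphere. -/
def scalarCurvature {n : ℕ} (g : Coord n → Matrix (Fin n) (Fin n) ℝ) (x : Coord n) : ℝ :=
  ∑ k, ∑ j, (g x)⁻¹ k j * ricci g k j x

/-- `g` has constant (sectional) curvature on `U`:
`R(X, Y) Z = κ (g(Y, Z) X - g(X, Z) Y)` with a constant `κ`. -/
def HasConstantCurvature {n : ℕ} (U : Set (Coord n))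
    (g : Coord n → Matrix (Fin n) (Fin n) ℝ) : Prop :=
  ∃ κ : ℝ, ∀ x ∈ U, ∀ l k i j, riemann g l k i j x =
    κ * ((if l = i then 1 else 0) * g x j k - (if l = j then 1 else 0) * g x i k)

/-- Second covariant derivative `f_{,ij}` of a function. -/
def hess {n : ℕ} (g : Coord n → Matrix (Fin n) (Fin n) ℝ) (f : Coord n → ℝ) (i j : Fin n)
    (x : Coord n) : ℝ :=
  pd j (pd i f) x - ∑ k, christoffel g k i j x * pd k f x

/-- Third covariant derivative `f_{,ijk} = ∇ₖ f_{,ij}` of a function. -/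
def third {n : ℕ} (g : Coord n → Matrix (Fin n) (Fin n) ℝ) (f : Coord n → ℝ) (i j k : Fin n)
    (x : Coord n) : ℝ :=
  pd k (hess g f i j) x
    - ∑ l, (christoffel g l k i x * hess g f l j x + christoffel g l k j x * hess g f i l x)

/-- The Laplacian `Δf = gⁱʲ f_{,ij}`. -/
def laplacian {n : ℕ} (g : Coord n → Matrix (Fin n) (Fin n) ℝ) (f : Coord n → ℝ)
    (x : Coord n) : ℝ :=
  ∑ i, ∑ j, (g x)⁻¹ i j * hess g f i j x

/-! ### Projections of tensors -/

/-- Sum of a 3-tensor over all permutations of its indices (the Young symmetriser of the row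
`ijk`, without normalisation). -/
def symm3 {n : ℕ} (A : Fin n → Fin n → Fin n → ℝ) (i j k : Fin n) : ℝ :=
  A i j k + A i k j + A j i k + A j k i + A k i j + A k j i

/-- Trace-free part, with respect to the metric value `h`, of a totally symmetric 3-tensor. -/
def traceFree3 {n : ℕ} (h : Matrix (Fin n) (Fin n) ℝ) (A : Fin n → Fin n → Fin n → ℝ)
    (i j k : Fin n) : ℝ :=
  A i j k - (1 / ((n : ℝ) + 2)) * (h i j * (∑ a, ∑ b, h⁻¹ a b * A a b k)
    + h j k * (∑ a, ∑ b, h⁻¹ a b * A a b i) + h i k * (∑ a, ∑ b, h⁻¹ a b * A a b j))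

/-- The totally symmetric, totally trace-free part of the third covariant derivative of `f`. -/
def thirdTF {n : ℕ} (g : Coord n → Matrix (Fin n) (Fin n) ℝ) (f : Coord n → ℝ)
    (i j k : Fin n) (x : Coord n) : ℝ :=
  (1 / 6) * traceFree3 (g x) (symm3 (fun a b c => third g f a b c x)) i j k

/-- `gᵢₖ Xⱼ` symmetrised in `i, j` (without normalisation) and made trace-free in `i, j`. -/
def tracePart {n : ℕ} (h : Matrix (Fin n) (Fin n) ℝ) (X : Fin n → ℝ) (i j k : Fin n) : ℝ :=
  h i k * X j + h j k * X i - (2 / (n : ℝ)) * (h i j * X k)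

/-! ### Superintegrable systems -/

/-- Poisson bracket on phase space with coordinates `(x, p)`. -/
def poisson {n : ℕ} (F G : Coord n × Coord n → ℝ) (z : Coord n × Coord n) : ℝ :=
  ∑ i, (fderiv ℝ F z (Pi.single i 1, 0) * fderiv ℝ G z (0, Pi.single i 1)
    - fderiv ℝ F z (0, Pi.single i 1) * fderiv ℝ G z (Pi.single i 1, 0))

/-- The function `Kⁱʲ(x) pᵢ pⱼ + W(x)` on phase space. -/
def quadratic {n : ℕ} (K : Coord n → Matrix (Fin n) (Fin n) ℝ) (W : Coord n → ℝ)
    (z : Coord n × Coord n) : ℝ :=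
  (∑ i, ∑ j, K z.1 i j * z.2 i * z.2 j) + W z.1

/-- The natural Hamiltonian `H = gⁱʲ pᵢ pⱼ + V`. -/
def hamiltonian {n : ℕ} (g : Coord n → Matrix (Fin n) (Fin n) ℝ) (V : Coord n → ℝ) :
    Coord n × Coord n → ℝ :=
  quadratic (fun x => (g x)⁻¹) V

/-- `F = Kⁱʲ pᵢ pⱼ + W` is a conformal integral of `H = gⁱʲ pᵢ pⱼ + V` over `U`:
`{F, H} = ρ H` with `ρ` linear in the momenta. -/
def IsConformalIntegral {n : ℕ} (U : Set (Coord n)) (g : Coord n → Matrix (Fin n) (Fin n) ℝ)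
    (V : Coord n → ℝ) (K : Coord n → Matrix (Fin n) (Fin n) ℝ) (W : Coord n → ℝ) : Prop :=
  ∃ ρ : Coord n → Fin n → ℝ, ∀ x ∈ U, ∀ p : Coord n,
    poisson (quadratic K W) (hamiltonian g V) (x, p)
      = (∑ i, ρ x i * p i) * hamiltonian g V (x, p)

/-- `T`, `τ` are structure tensors for the metric `g` and the family of potentials `V`:
`T x i j m` is `Tᵢⱼᵐ`, and every potential satisfies the Wilczynski equation
`V_{,ij} = Tᵢⱼᵐ V_{,m} + (1/n) gᵢⱼ ΔV + τᵢⱼ V`. -/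
structure IsStructureTensors {n : ℕ} {ι : Type} (U : Set (Coord n))
    (g : Coord n → Matrix (Fin n) (Fin n) ℝ) (V : ι → Coord n → ℝ)
    (T : Coord n → Fin n → Fin n → Fin n → ℝ) (τ : Coord n → Fin n → Fin n → ℝ) : Prop where
  smooth_T : ∀ i j m, ContDiffOn ℝ ∞ (fun x => T x i j m) U
  smooth_τ : ∀ i j, ContDiffOn ℝ ∞ (fun x => τ x i j) U
  symm_T : ∀ x ∈ U, ∀ i j m, T x j i m = T x i j m
  symm_τ : ∀ x ∈ U, ∀ i j, τ x j i = τ x i j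
  trace_T : ∀ x ∈ U, ∀ m, ∑ i, ∑ j, (g x)⁻¹ i j * T x i j m = 0
  trace_τ : ∀ x ∈ U, ∑ i, ∑ j, (g x)⁻¹ i j * τ x i j = 0
  wilczynski : ∀ a, ∀ x ∈ U, ∀ i j, hess g (V a) i j x =
    (∑ m, T x i j m * pd m (V a) x) + (1 / (n : ℝ)) * g x i j * laplacian g (V a) x
      + τ x i j * V a x

/-- A non-degenerate second-order conformally superintegrable (Wilczynski) system on `U`: a metric,
a linear family of potentials spanned by `n + 2` linearly independent functions `V a` solving one
Wilczynski equation, and trace-free symmetric tensors `K α` (upper indices) giving conformal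
integrals for every potential of the family.  Together with the Hamiltonian there are at least
`2 n - 1` linearly independent integrals; functional independence is not required, so that
abundant systems (`r + 1 = n (n + 1) / 2`) are included.  Proper systems (`τ = 0`) are included
through the trace-free parts of their Killing tensors. -/
structure NondegenerateSystem (n : ℕ) (U : Set (Coord n)) where
  g : Coord n → Matrix (Fin n) (Fin n) ℝ
  isMetric : IsMetric U g
  V : Fin (n + 2) → Coord n → ℝ
  smooth_V : ∀ a, ContDiffOn ℝ ∞ (V a) U
  linearIndependent_V : LinearIndependent ℝ (fun a => U.domRestrict (V a))
  exists_structureTensors : ∃ T τ, IsStructureTensors U g V T τ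
  r : ℕ
  K : Fin r → Coord n → Matrix (Fin n) (Fin n) ℝ
  smooth_K : ∀ α i j, ContDiffOn ℝ ∞ (fun x => K α x i j) U
  symm_K : ∀ α, ∀ x ∈ U, ∀ i j, K α x i j = K α x j i
  trace_K : ∀ α, ∀ x ∈ U, ∑ i, ∑ j, g x i j * K α x i j = 0
  linearIndependent_K : LinearIndependent ℝ (fun α => U.domRestrict (K α))
  le_card : 2 * n - 1 ≤ r + 1
  integrals : ∀ α a, ∃ W : Coord n → ℝ, ContDiffOn ℝ ∞ W U ∧
    IsConformalIntegral U g (V a) (K α) W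

/-- Conformal equivalence `H̃ = Ω⁻² H`: the metric changes to `Ω² g`, the potentials are multiplied
by `Ω⁻²`, and the trace-free (conformal) Killing tensors with upper indices span the same space. -/
structure ConformallyEquivalent {n : ℕ} {U : Set (Coord n)} (S S' : NondegenerateSystem n U)
    (Ω : Coord n → ℝ) : Prop where
  smooth : ContDiffOn ℝ ∞ Ω U
  ne_zero : ∀ x ∈ U, Ω x ≠ 0
  metric : ∀ x ∈ U, S'.g x = (Ω x) ^ 2 • S.g x
  potentials : Submodule.span ℝ (Set.range fun a => U.domRestrict (S'.V a)) =
    Submodule.span ℝ (Set.range fun a => U.domRestrict fun x => ((Ω x) ^ 2)⁻¹ * S.V a x)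
  tensors : Submodule.span ℝ (Set.range fun α => U.domRestrict (S'.K α)) =
    Submodule.span ℝ (Set.range fun α => U.domRestrict (S.K α))

/-! ### Structure functions -/

/-- The structure tensor with all indices down, `Tᵢⱼₖ = gₖₘ Tᵢⱼᵐ`. -/
def lower {n : ℕ} (g : Coord n → Matrix (Fin n) (Fin n) ℝ)
    (T : Coord n → Fin n → Fin n → Fin n → ℝ) (i j k : Fin n) (x : Coord n) : ℝ :=
  ∑ m, g x k m * T x i j m

/-- `B` is a structure function of `T`: with `Y` the Young symmetrisers,
`Tᵢⱼₖ = (1/6) (Y(ijk) B_{,ijk})₀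
  + (1/(n+2)) (Y(ij) gᵢₖ ((ΔB)_{,j} + (2(n+1)/(n(n-1))) R B_{,j}))₀`. -/
def IsStructureFunction {n : ℕ} (U : Set (Coord n)) (g : Coord n → Matrix (Fin n) (Fin n) ℝ)
    (T : Coord n → Fin n → Fin n → Fin n → ℝ) (B : Coord n → ℝ) : Prop :=
  ∀ x ∈ U, ∀ i j k, lower g T i j k x = thirdTF g B i j k x +
    tracePart (g x) (fun l => (1 / ((n : ℝ) + 2)) * (pd l (laplacian g B) x +
      2 * ((n : ℝ) + 1) / ((n : ℝ) * ((n : ℝ) - 1)) * scalarCurvature g x * pd l B x)) i j k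

/-- `(B, t)` is a pair of structure functions of `T`:
`Tᵢⱼₖ = Sᵢⱼₖ + (Y(ij) gᵢₖ t_{,j})₀` with `Sᵢⱼₖ = (1/6) (Y(ijk) B_{,ijk})₀`. -/
def IsStructurePair {n : ℕ} (U : Set (Coord n)) (g : Coord n → Matrix (Fin n) (Fin n) ℝ)
    (T : Coord n → Fin n → Fin n → Fin n → ℝ) (B t : Coord n → ℝ) : Prop :=
  ∀ x ∈ U, ∀ i j k, lower g T i j k x =
    thirdTF g B i j k x + tracePart (g x) (fun l => pd l t x) i j k

/-- The function `(1/(n+2)) (ΔB + (2(n+1)/(n(n-1))) R B)`; on a space of constant curvature it is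
the potential of the trace part of a structure tensor with structure function `B`. -/
def tbar {n : ℕ} (g : Coord n → Matrix (Fin n) (Fin n) ℝ) (B : Coord n → ℝ) (x : Coord n) : ℝ :=
  (1 / ((n : ℝ) + 2)) * (laplacian g B x +
    2 * ((n : ℝ) + 1) / ((n : ℝ) * ((n : ℝ) - 1)) * scalarCurvature g x * B x)

/-- `q` is a gauge function: adding it to `B` does not change `(Y(ijk) B_{,ijk})₀`. -/
def IsGauge {n : ℕ} (U : Set (Coord n)) (g : Coord n → Matrix (Fin n) (Fin n) ℝ)
    (q : Coord n → ℝ) : Prop :=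
  ∀ x ∈ U, ∀ i j k, thirdTF g q i j k x = 0

end Superintegrable

end

open scoped ContDiff

noncomputable section

namespace Superintegrable

/-! ### Coordinate derivatives of smooth functions. -/

section Calculus

variable {n : ℕ} {U : Set (Coord n)} {f f₁ f₂ : Coord n → ℝ} {x : Coord n}

/-! Put `Y = ln |Ω|`, so that the second metric is `e^{2Y} g` and its potentials are spanned by the
functions `e^{-2Y} V`. Both sides of the structure equation turn out to be multiplied by `e^{2Y}`,
apart from one term that is absorbed by `t ↦ t - 3Y`.

On the left, `conformal_lower` gives `T'ᵢⱼₖ = e^{2Y} (Tᵢⱼₖ - 3 · tracePart(dY)ᵢⱼₖ)`. The reason is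
that the `n + 2` potentials realise every value, gradient and Laplacian at a given point: these data
satisfy a closed first-order linear system (`isDominated_pd_jet`), so a potential whose data vanish
at one point is zero (`eq_zero_of_isDominated`), and the dimensions agree. A potential `W` with `W =
0` and `dW = dxᵏ` at the point isolates `Tᵢⱼᵏ` in the Wilczynski equation. Comparing the equations
of `W` and `e^{-2Y} W` gives `T'` modulo a multiple of `g`, and trace-freeness fixes that multiple.

On the right, `thirdTF_conformal` says that the trace-free symmetrised third derivative of `e^{2Y}
B` is `e^{2Y}` times that of `B`. This is where constant curvature of both metrics enters: together
with `n ≥ 3` it forces `∇²Y - dY ⊗ dY` to be a multiple of `g` (`hess_eq_of_hasConstantCurvature`),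
after which everything of lower order cancels or is a trace.

For uniqueness, contracting the last two indices kills the trace-free part and returns a nonzero
multiple of `dt`. Hence `dt` is determined by `T`, and `t` up to a constant on connected `U`. What
is left of `B` is the kernel of the third-order operator, that is, gauge functions. A structure
function alone gives a pair because `R` is constant. -/

theorem differentiableAt_of_smooth (hU : IsOpen U) (hf : ContDiffOn ℝ ∞ f U) (hx : x ∈ U) :
    DifferentiableAt ℝ f x :=
  (hf.contDiffAt (hU.mem_nhds hx)).differentiableAt (by simp)

theorem pd_add (i : Fin n) (h₁ : DifferentiableAt ℝ f₁ x) (h₂ : DifferentiableAt ℝ f₂ x) :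
    pd i (fun y => f₁ y + f₂ y) x = pd i f₁ x + pd i f₂ x := by
  simp only [pd]
  rw [fderiv_fun_add h₁ h₂]; rfl

theorem pd_sub (i : Fin n) (h₁ : DifferentiableAt ℝ f₁ x) (h₂ : DifferentiableAt ℝ f₂ x) :
    pd i (fun y => f₁ y - f₂ y) x = pd i f₁ x - pd i f₂ x := by
  simp only [pd]
  rw [fderiv_fun_sub h₁ h₂]; rfl

theorem pd_mul (i : Fin n) (h₁ : DifferentiableAt ℝ f₁ x) (h₂ : DifferentiableAt ℝ f₂ x) :
    pd i (fun y => f₁ y * f₂ y) x = pd i f₁ x * f₂ x + f₁ x * pd i f₂ x := by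
  simp only [pd]
  rw [fderiv_fun_mul h₁ h₂]
  simp only [add_apply, smul_apply, smul_eq_mul]
  ring

theorem pd_const (i : Fin n) (c : ℝ) : pd i (fun _ => c) x = 0 := by
  simp [pd]

theorem pd_const_mul (i : Fin n) (c : ℝ) (h : DifferentiableAt ℝ f x) :
    pd i (fun y => c * f y) x = c * pd i f x := by
  rw [pd_mul i (differentiableAt_const c) h, pd_const]; ring

theorem pd_sum {ι : Type*} (s : Finset ι) (i : Fin n) {F : ι → Coord n → ℝ}
    (h : ∀ a ∈ s, DifferentiableAt ℝ (F a) x) :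
    pd i (fun y => ∑ a ∈ s, F a y) x = ∑ a ∈ s, pd i (F a) x := by
  simp only [pd]
  rw [fderiv_fun_sum h]
  simp

theorem pd_congr (hU : IsOpen U) (h : ∀ y ∈ U, f₁ y = f₂ y) (hx : x ∈ U) (i : Fin n) :
    pd i f₁ x = pd i f₂ x := by
  have : f₁ =ᶠ[nhds x] f₂ := Filter.eventuallyEq_of_mem (hU.mem_nhds hx) h
  simp only [pd, this.fderiv_eq]

theorem pd_exp (i : Fin n) (h : DifferentiableAt ℝ f x) :
    pd i (fun y => Real.exp (f y)) x = Real.exp (f x) * pd i f x := by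
  simp only [pd]
  rw [fderiv_exp h]; simp

theorem smooth_pd (hU : IsOpen U) (hf : ContDiffOn ℝ ∞ f U) (i : Fin n) :
    ContDiffOn ℝ ∞ (pd i f) U :=
  (hf.fderiv_of_isOpen (m := ∞) hU (by simp)).clm_apply contDiffOn_const

theorem pd_comm (hU : IsOpen U) (hf : ContDiffOn ℝ ∞ f U) (hx : x ∈ U) (i j : Fin n) :
    pd i (pd j f) x = pd j (pd i f) x := by
  have hd : DifferentiableAt ℝ (fderiv ℝ f) x :=
    ((hf.fderiv_of_isOpen (m := ∞) hU (by simp)).contDiffAt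
      (hU.mem_nhds hx)).differentiableAt (by simp)
  have key : ∀ i j : Fin n, pd i (pd j f) x =
      fderiv ℝ (fderiv ℝ f) x (Pi.single i 1) (Pi.single j 1) := by
    intro i j
    rw [pd, show pd j f =
      (fun y => (fderiv ℝ f y) ((fun _ => (Pi.single j 1 : Coord n)) y)) from rfl,
      fderiv_clm_apply hd (differentiableAt_const (Pi.single j 1))]
    simp
  rw [key, key]
  exact (hf.contDiffAt (hU.mem_nhds hx)).isSymmSndFDerivAt
    (by
      rw [minSmoothness_of_isRCLikeNormedField]
      exact WithTop.coe_le_coe.mpr (le_top : (2 : ℕ∞) ≤ ⊤)) _ _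

theorem fderiv_apply_eq_sum_pd (v : Coord n) :
    fderiv ℝ f x v = ∑ i, v i * pd i f x := by
  conv_lhs => rw [← Finset.univ_sum_single v]
  rw [map_sum]
  refine Finset.sum_congr rfl fun i _ => ?_
  rw [pd, ← smul_eq_mul, ← map_smul, ← Pi.single_smul, smul_eq_mul, mul_one]

/-- Turns bounds on coordinate derivatives into the operator-norm bound needed by the mean value
inequality. -/
theorem norm_fderiv_le_sum_pd : ‖fderiv ℝ f x‖ ≤ ∑ i, |pd i f x| := by
  refine ContinuousLinearMap.opNorm_le_bound _ (by positivity) fun v => ?_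
  rw [fderiv_apply_eq_sum_pd, Finset.sum_mul]
  refine (Finset.abs_sum_le_sum_abs _ _).trans (Finset.sum_le_sum fun i _ => ?_)
  rw [abs_mul, mul_comm]
  exact mul_le_mul_of_nonneg_left (norm_le_pi_norm v i) (abs_nonneg _)

theorem exists_const_of_pd_eq_zero (hU : IsOpen U) (hUc : IsConnected U)
    (hf : ContDiffOn ℝ ∞ f U) (h : ∀ x ∈ U, ∀ i, pd i f x = 0) : ∃ c, ∀ x ∈ U, f x = c := by
  refine hU.exists_is_const_of_fderiv_eq_zero (𝕜 := ℝ) hUc.isPreconnected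
    (hf.differentiableOn (by simp)) fun x hx => ?_
  ext v
  rw [fderiv_apply_eq_sum_pd]
  simp [h x hx]

theorem smooth_det {m : ℕ} {M : Coord n → Matrix (Fin m) (Fin m) ℝ}
    (hM : ∀ i j, ContDiffOn ℝ ∞ (fun x => M x i j) U) :
    ContDiffOn ℝ ∞ (fun x => (M x).det) U := by
  simp only [Matrix.det_apply']
  exact ContDiffOn.sum fun σ _ => contDiffOn_const.mul (contDiffOn_prod fun i _ => hM _ _)

/-- By Cramer's rule each entry of the inverse is a quotient of determinants. -/
theorem smooth_inv {M : Coord n → Matrix (Fin n) (Fin n) ℝ}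
    (hM : ∀ i j, ContDiffOn ℝ ∞ (fun x => M x i j) U) (hdet : ∀ x ∈ U, (M x).det ≠ 0)
    (i j : Fin n) : ContDiffOn ℝ ∞ (fun x => (M x)⁻¹ i j) U := by
  simp only [Matrix.inv_def, Ring.inverse_eq_inv', Matrix.smul_apply, smul_eq_mul,
    Matrix.adjugate_apply]
  refine ((smooth_det hM).inv hdet).mul (smooth_det fun k l => ?_)
  -- The updated row is a constant unit vector; all other rows are those of `M`.
  by_cases h : k = j
  · subst h; simpa using contDiffOn_const
  · simpa [Matrix.updateRow_ne h] using hM k l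

end Calculus

/-! ### The Levi-Civita connection in coordinates. -/

section Geometry

variable {n : ℕ} {U : Set (Coord n)} {g : Coord n → Matrix (Fin n) (Fin n) ℝ}
  {f : Coord n → ℝ} {x : Coord n}

theorem IsMetric.smooth_inv (hg : IsMetric U g) (i j : Fin n) :
    ContDiffOn ℝ ∞ (fun x => (g x)⁻¹ i j) U :=
  Superintegrable.smooth_inv hg.smooth hg.nondegenerate i j

theorem IsMetric.smooth_christoffel (hU : IsOpen U) (hg : IsMetric U g) (k i j : Fin n) :
    ContDiffOn ℝ ∞ (christoffel g k i j) U :=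
  contDiffOn_const.mul (ContDiffOn.sum fun l _ => (hg.smooth_inv k l).mul
    (((smooth_pd hU (hg.smooth j l) i).add (smooth_pd hU (hg.smooth i l) j)).sub
      (smooth_pd hU (hg.smooth i j) l)))

theorem IsMetric.smooth_hess (hU : IsOpen U) (hg : IsMetric U g) (hf : ContDiffOn ℝ ∞ f U)
    (i j : Fin n) : ContDiffOn ℝ ∞ (hess g f i j) U :=
  (smooth_pd hU (smooth_pd hU hf i) j).sub (ContDiffOn.sum fun k _ =>
    (hg.smooth_christoffel hU k i j).mul (smooth_pd hU hf k))

theorem IsMetric.smooth_laplacian (hU : IsOpen U) (hg : IsMetric U g)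
    (hf : ContDiffOn ℝ ∞ f U) : ContDiffOn ℝ ∞ (laplacian g f) U :=
  ContDiffOn.sum fun i _ => ContDiffOn.sum fun j _ =>
    (hg.smooth_inv i j).mul (hg.smooth_hess hU hf i j)

theorem IsMetric.isUnit_det (hg : IsMetric U g) (hx : x ∈ U) : IsUnit (g x).det :=
  isUnit_iff_ne_zero.mpr (hg.nondegenerate x hx)

theorem IsMetric.sum_mul_inv (hg : IsMetric U g) (hx : x ∈ U) (i j : Fin n) :
    ∑ k, g x i k * (g x)⁻¹ k j = if i = j then 1 else 0 := by
  have := congrFun₂ (Matrix.mul_nonsing_inv (g x) (hg.isUnit_det hx)) i j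
  rwa [Matrix.mul_apply, Matrix.one_apply] at this

theorem IsMetric.sum_inv_mul (hg : IsMetric U g) (hx : x ∈ U) (i j : Fin n) :
    ∑ k, (g x)⁻¹ i k * g x k j = if i = j then 1 else 0 := by
  have := congrFun₂ (Matrix.nonsing_inv_mul (g x) (hg.isUnit_det hx)) i j
  rwa [Matrix.mul_apply, Matrix.one_apply] at this

theorem IsMetric.inv_symm (hg : IsMetric U g) (hx : x ∈ U) (i j : Fin n) :
    (g x)⁻¹ i j = (g x)⁻¹ j i := by
  have h : (g x).transpose = g x := by
    ext a b; exact (hg.symm x hx b a)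
  have := congrFun₂ (Matrix.transpose_nonsing_inv (g x)) i j
  rw [h, Matrix.transpose_apply] at this
  exact this.symm

/-- Contracting one index with `g` and then with `g⁻¹` is the identity. -/
theorem IsMetric.sum_lower_raise (hg : IsMetric U g) (hx : x ∈ U) (X : Fin n → ℝ) (i : Fin n) :
    ∑ k, g x i k * ∑ l, (g x)⁻¹ k l * X l = X i := by
  simp only [Finset.mul_sum, ← mul_assoc]
  rw [Finset.sum_comm]
  simp only [← Finset.sum_mul, hg.sum_mul_inv hx]
  simp

theorem IsMetric.pd_symm (hU : IsOpen U) (hg : IsMetric U g) (hx : x ∈ U) (k i j : Fin n) :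
    pd k (fun y => g y i j) x = pd k (fun y => g y j i) x :=
  pd_congr hU (fun y hy => hg.symm y hy i j) hx k

theorem IsMetric.christoffel_symm (hU : IsOpen U) (hg : IsMetric U g) (hx : x ∈ U)
    (k i j : Fin n) : christoffel g k i j x = christoffel g k j i x := by
  simp only [christoffel]
  congr 1
  refine Finset.sum_congr rfl fun l _ => ?_
  rw [hg.pd_symm hU hx l i j]; ring

theorem IsMetric.hess_symm (hU : IsOpen U) (hg : IsMetric U g) (hf : ContDiffOn ℝ ∞ f U)
    (hx : x ∈ U) (i j : Fin n) : hess g f i j x = hess g f j i x := by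
  simp only [hess]
  rw [pd_comm hU hf hx j i]
  simp only [hg.christoffel_symm hU hx _ i j]

theorem IsMetric.lower_christoffel (hg : IsMetric U g) (hx : x ∈ U)
    (l i j : Fin n) : ∑ m, g x l m * christoffel g m i j x = (1 / 2) *
      (pd i (fun y => g y j l) x + pd j (fun y => g y i l) x - pd l (fun y => g y i j) x) := by
  rw [← hg.sum_lower_raise hx (fun l => (1 / 2) * (pd i (fun y => g y j l) x +
    pd j (fun y => g y i l) x - pd l (fun y => g y i j) x)) l]
  refine Finset.sum_congr rfl fun m _ => ?_
  rw [christoffel, Finset.mul_sum]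
  congr 1
  exact Finset.sum_congr rfl fun k _ => by ring

/-- The Levi-Civita connection is metric. -/
theorem IsMetric.pd_metric (hU : IsOpen U) (hg : IsMetric U g) (hx : x ∈ U) (i j k : Fin n) :
    pd k (fun y => g y i j) x =
      ∑ l, (christoffel g l k i x * g x l j + christoffel g l k j x * g x i l) := by
  rw [Finset.sum_add_distrib]
  have h₁ := hg.lower_christoffel hx j k i
  have h₂ := hg.lower_christoffel hx i k j
  rw [show ∑ l, christoffel g l k i x * g x l j = ∑ m, g x j m * christoffel g m k i x from
      Finset.sum_congr rfl fun m _ => by rw [hg.symm x hx m j]; ring, h₁,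
    show ∑ l, christoffel g l k j x * g x i l = ∑ m, g x i m * christoffel g m k j x from
      Finset.sum_congr rfl fun m _ => by ring, h₂]
  rw [hg.pd_symm hU hx k j i, hg.pd_symm hU hx i k j, hg.pd_symm hU hx j k i]
  ring

end Geometry

/-! ### Christoffel symbols and Hessians under `g ↦ e^{2Y} g`. -/

section Conformal

variable {n : ℕ} {U : Set (Coord n)} {g g' : Coord n → Matrix (Fin n) (Fin n) ℝ}
  {Y f : Coord n → ℝ} {x : Coord n}

/-- The components `gᵏˡ ∂ₗ f` of the gradient of `f`. -/
def grad (g : Coord n → Matrix (Fin n) (Fin n) ℝ) (f : Coord n → ℝ) (k : Fin n)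
    (x : Coord n) : ℝ :=
  ∑ l, (g x)⁻¹ k l * pd l f x

theorem IsMetric.smooth_grad (hU : IsOpen U) (hg : IsMetric U g) (hf : ContDiffOn ℝ ∞ f U)
    (k : Fin n) : ContDiffOn ℝ ∞ (grad g f k) U :=
  ContDiffOn.sum fun l _ => (hg.smooth_inv k l).mul (smooth_pd hU hf l)

theorem IsMetric.lower_grad (hg : IsMetric U g) (hx : x ∈ U) (i : Fin n) :
    ∑ k, g x i k * grad g f k x = pd i f x :=
  hg.sum_lower_raise hx (fun l => pd l f x) i

theorem conformal_inv (hg : IsMetric U g) (hx : x ∈ U)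
    (h : ∀ x ∈ U, g' x = Real.exp (2 * Y x) • g x) :
    (g' x)⁻¹ = (Real.exp (2 * Y x))⁻¹ • (g x)⁻¹ := by
  apply Matrix.inv_eq_left_inv
  rw [h x hx, Matrix.smul_mul, Matrix.mul_smul, smul_smul,
    Matrix.nonsing_inv_mul _ (hg.isUnit_det hx), inv_mul_cancel₀ (Real.exp_pos _).ne', one_smul]

theorem conformal_pd_metric (hU : IsOpen U) (hg : IsMetric U g) (hY : ContDiffOn ℝ ∞ Y U)
    (h : ∀ x ∈ U, g' x = Real.exp (2 * Y x) • g x) (hx : x ∈ U) (i j k : Fin n) :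
    pd k (fun y => g' y i j) x = Real.exp (2 * Y x) *
      (2 * pd k Y x * g x i j + pd k (fun y => g y i j) x) := by
  have hYd := differentiableAt_of_smooth hU hY hx
  have hY2 : DifferentiableAt ℝ (fun y => 2 * Y y) x := hYd.const_mul 2
  rw [pd_congr hU (f₂ := fun y => Real.exp (2 * Y y) * g y i j)
    (fun y hy => by rw [h y hy]; rfl) hx, pd_mul k hY2.exp
    (differentiableAt_of_smooth hU (hg.smooth i j) hx), pd_exp k hY2, pd_const_mul k 2 hYd]
  ring

/-- Differentiating the factor `e^{2Y}` in the three metric derivatives produces the three extra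
terms, and the factor itself cancels against the inverse metric. -/
theorem conformal_christoffel (hU : IsOpen U) (hg : IsMetric U g) (hY : ContDiffOn ℝ ∞ Y U)
    (h : ∀ x ∈ U, g' x = Real.exp (2 * Y x) • g x) (hx : x ∈ U) (k i j : Fin n) :
    christoffel g' k i j x = christoffel g k i j x + (if k = i then 1 else 0) * pd j Y x
      + (if k = j then 1 else 0) * pd i Y x - g x i j * grad g Y k x := by
  have e := (Real.exp_pos (2 * Y x)).ne'
  have key : christoffel g' k i j x = christoffel g k i j x +
      (∑ l, (g x)⁻¹ k l * g x l j) * pd i Y x + (∑ l, (g x)⁻¹ k l * g x l i) * pd j Y x -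
      g x i j * grad g Y k x := by
    simp only [christoffel, grad, Finset.mul_sum, Finset.sum_mul, ← Finset.sum_add_distrib,
      ← Finset.sum_sub_distrib]
    refine Finset.sum_congr rfl fun l _ => ?_
    rw [conformal_inv hg hx h, conformal_pd_metric hU hg hY h hx,
      conformal_pd_metric hU hg hY h hx, conformal_pd_metric hU hg hY h hx, Matrix.smul_apply,
      smul_eq_mul, hg.symm x hx l i, hg.symm x hx l j]
    field_simp
    ring
  rw [key, hg.sum_inv_mul hx, hg.sum_inv_mul hx]
  ring

theorem conformal_hess (hU : IsOpen U) (hg : IsMetric U g) (hY : ContDiffOn ℝ ∞ Y U)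
    (h : ∀ x ∈ U, g' x = Real.exp (2 * Y x) • g x) (hx : x ∈ U) (i j : Fin n) :
    hess g' f i j x = hess g f i j x - pd i Y x * pd j f x - pd j Y x * pd i f x
      + g x i j * ∑ k, grad g Y k x * pd k f x := by
  simp only [hess, conformal_christoffel hU hg hY h hx, sub_mul, add_mul,
    Finset.sum_add_distrib, Finset.sum_sub_distrib, ite_mul, one_mul, zero_mul,
    Finset.sum_ite_eq', Finset.mem_univ, if_true, Finset.mul_sum, mul_assoc]
  ring

theorem hess_mul (hU : IsOpen U) {f₁ f₂ : Coord n → ℝ} (h₁ : ContDiffOn ℝ ∞ f₁ U)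
    (h₂ : ContDiffOn ℝ ∞ f₂ U) (hx : x ∈ U) (i j : Fin n) :
    hess g (fun y => f₁ y * f₂ y) i j x = f₁ x * hess g f₂ i j x + pd i f₁ x * pd j f₂ x
      + pd j f₁ x * pd i f₂ x + f₂ x * hess g f₁ i j x := by
  have d : ∀ {f : Coord n → ℝ}, ContDiffOn ℝ ∞ f U → ∀ y ∈ U, DifferentiableAt ℝ f y :=
    fun hf y hy => differentiableAt_of_smooth hU hf hy
  have e : ∀ (i : Fin n), ∀ y ∈ U, pd i (fun y => f₁ y * f₂ y) y =
      pd i f₁ y * f₂ y + f₁ y * pd i f₂ y := fun i y hy => pd_mul i (d h₁ y hy) (d h₂ y hy)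
  simp only [hess]
  rw [pd_congr hU (e i) hx, pd_add j ((d (smooth_pd hU h₁ i) x hx).fun_mul (d h₂ x hx))
    ((d h₁ x hx).fun_mul (d (smooth_pd hU h₂ i) x hx)), pd_mul j (d (smooth_pd hU h₁ i) x hx)
    (d h₂ x hx), pd_mul j (d h₁ x hx) (d (smooth_pd hU h₂ i) x hx)]
  simp only [e _ x hx, mul_add, Finset.sum_add_distrib, mul_sub, Finset.mul_sum]
  have r₁ : ∑ k, christoffel g k i j x * (pd k f₁ x * f₂ x) =
      ∑ k, f₂ x * (christoffel g k i j x * pd k f₁ x) :=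
    Finset.sum_congr rfl fun k _ => by ring
  have r₂ : ∑ k, christoffel g k i j x * (f₁ x * pd k f₂ x) =
      ∑ k, f₁ x * (christoffel g k i j x * pd k f₂ x) :=
    Finset.sum_congr rfl fun k _ => by ring
  rw [r₁, r₂]
  ring

/-- `∇ᵢ ∇ⱼ e^{cY}`, divided by `e^{cY}`. -/
theorem hess_exp (hU : IsOpen U) (hY : ContDiffOn ℝ ∞ Y U) (hx : x ∈ U) (c : ℝ) (i j : Fin n) :
    hess g (fun y => Real.exp (c * Y y)) i j x =
      Real.exp (c * Y x) * (c * hess g Y i j x + c ^ 2 * (pd i Y x * pd j Y x)) := by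
  have hYd : ∀ y ∈ U, DifferentiableAt ℝ Y y := fun y hy => differentiableAt_of_smooth hU hY hy
  have e : ∀ (i : Fin n), ∀ y ∈ U, pd i (fun y => Real.exp (c * Y y)) y =
      c * (Real.exp (c * Y y) * pd i Y y) := fun i y hy => by
    rw [pd_exp i ((hYd y hy).const_mul c), pd_const_mul i c (hYd y hy)]; ring
  have hp := differentiableAt_of_smooth hU (smooth_pd hU hY i) hx
  have hE : DifferentiableAt ℝ (fun y => Real.exp (c * Y y)) x := ((hYd x hx).const_mul c).exp
  simp only [hess]
  rw [pd_congr hU (e i) hx, pd_const_mul j c (hE.fun_mul hp), pd_mul j hE hp]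
  simp only [e _ x hx]
  rw [show ∑ k, christoffel g k i j x * (c * (Real.exp (c * Y x) * pd k Y x)) =
    Real.exp (c * Y x) * (c * ∑ k, christoffel g k i j x * pd k Y x) by
      simp only [Finset.mul_sum]; exact Finset.sum_congr rfl fun k _ => by ring]
  ring

end Conformal

/-! ### Curvature under conformal change, and its consequence for the conformal factor. -/

section Curvature

variable {n : ℕ} {U : Set (Coord n)} {g g' : Coord n → Matrix (Fin n) (Fin n) ℝ}
  {Y f : Coord n → ℝ} {x : Coord n}

/-- Covariant derivative `∇ᵢ Yˡ` of the gradient of `Y`. -/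
def covGrad (g : Coord n → Matrix (Fin n) (Fin n) ℝ) (Y : Coord n → ℝ) (i l : Fin n)
    (x : Coord n) : ℝ :=
  pd i (grad g Y l) x + ∑ m, christoffel g l i m x * grad g Y m x

/-- Lowering an index commutes with `∇`, because the connection is metric. -/
theorem IsMetric.lower_covGrad (hU : IsOpen U) (hg : IsMetric U g) (hY : ContDiffOn ℝ ∞ Y U)
    (hx : x ∈ U) (i k : Fin n) : ∑ l, g x k l * covGrad g Y i l x = hess g Y k i x := by
  have d : ∀ {f : Coord n → ℝ}, ContDiffOn ℝ ∞ f U → DifferentiableAt ℝ f x :=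
    fun hf => differentiableAt_of_smooth hU hf hx
  have e : pd i (pd k Y) x = ∑ l, (pd i (fun y => g y k l) x * grad g Y l x
      + g x k l * pd i (grad g Y l) x) := by
    rw [← pd_congr hU (fun y hy => hg.lower_grad (f := Y) hy k) hx, pd_sum _ _ fun l _ =>
      (d (hg.smooth k l)).fun_mul (d (hg.smooth_grad hU hY l))]
    exact Finset.sum_congr rfl fun l _ => pd_mul i (d (hg.smooth k l)) (d (hg.smooth_grad hU hY l))
  have c₁ : ∑ l, pd i (fun y => g y k l) x * grad g Y l x =
      ∑ m, christoffel g m k i x * pd m Y x +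
        ∑ l, g x k l * ∑ m, christoffel g l i m x * grad g Y m x := by
    simp only [hg.pd_metric hU hx, Finset.sum_add_distrib, add_mul, Finset.sum_mul,
      Finset.mul_sum]
    congr 1
    · rw [Finset.sum_comm]
      refine Finset.sum_congr rfl fun m _ => ?_
      rw [← hg.lower_grad hx m, Finset.mul_sum, hg.christoffel_symm hU hx m k i]
      exact Finset.sum_congr rfl fun l _ => by ring
    · rw [Finset.sum_comm]
      exact Finset.sum_congr rfl fun m _ => Finset.sum_congr rfl fun l _ => by ring
  simp only [hess, covGrad, e, mul_add, Finset.sum_add_distrib, c₁]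
  ring

/-- The `ΓΓ` term of the curvature after a conformal change, as pure algebra: `G` stands for the
Christoffel symbols, `h` for the metric, `a` for `dY` and `b` for the gradient of `Y`. -/
theorem sum_conformal_product (G : Fin n → Fin n → Fin n → ℝ) (h : Fin n → Fin n → ℝ)
    (a b : Fin n → ℝ) (l i j k : Fin n) :
    ∑ m, (G l i m + (if l = i then 1 else 0) * a m + (if l = m then 1 else 0) * a i
        - h i m * b l) * (G m j k + (if m = j then 1 else 0) * a k
        + (if m = k then 1 else 0) * a j - h j k * b m) =
      ∑ m, G l i m * G m j k + G l i j * a k + G l i k * a j - h j k * ∑ m, G l i m * b m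
      + (if l = i then 1 else 0) * (∑ m, a m * G m j k + 2 * (a j * a k)
        - h j k * ∑ m, a m * b m)
      + a i * (G l j k + (if l = j then 1 else 0) * a k + (if l = k then 1 else 0) * a j
        - h j k * b l)
      - b l * (∑ m, h i m * G m j k + h i j * a k + h i k * a j
        - h j k * ∑ m, h i m * b m) := by
  have split : ∀ m, (G l i m + (if l = i then 1 else 0) * a m + (if l = m then 1 else 0) * a i
        - h i m * b l) * (G m j k + (if m = j then 1 else 0) * a k
        + (if m = k then 1 else 0) * a j - h j k * b m) =
      G l i m * G m j k + (if m = j then G l i m else 0) * a k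
      + (if m = k then G l i m else 0) * a j - h j k * (G l i m * b m)
      + (if l = i then 1 else 0) * (a m * G m j k + (if m = j then a m else 0) * a k
        + (if m = k then a m else 0) * a j - h j k * (a m * b m))
      + (if l = m then G m j k + (if m = j then 1 else 0) * a k
        + (if m = k then 1 else 0) * a j - h j k * b m else 0) * a i
      - b l * (h i m * G m j k + (if m = j then h i m else 0) * a k
        + (if m = k then h i m else 0) * a j - h j k * (h i m * b m)) := by
    intro m
    have : ∀ (p : Prop) [Decidable p] (t : ℝ), (if p then t else 0) = (if p then 1 else 0) * t :=
      fun p _ t => by split_ifs <;> simp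
    rw [this (m = j) (G l i m), this (m = k) (G l i m), this (m = j) (a m), this (m = k) (a m),
      this (m = j) (h i m), this (m = k) (h i m), this (l = m) (_ - _)]
    ring
  simp only [split, Finset.sum_add_distrib, Finset.sum_sub_distrib, ← Finset.mul_sum,
    ← Finset.sum_mul, Finset.sum_ite_eq, Finset.sum_ite_eq', Finset.mem_univ, if_true]
  ring

/-- The Christoffel symbols change by a tensor `C`, so the curvature changes by the alternation of
`∇C + CC`. In coordinates, the non-tensorial terms combine into the Hessian and `covGrad`, or cancel
by symmetry of the Christoffel symbols. -/
theorem conformal_riemann (hU : IsOpen U) (hg : IsMetric U g) (hY : ContDiffOn ℝ ∞ Y U)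
    (h : ∀ x ∈ U, g' x = Real.exp (2 * Y x) • g x) (hx : x ∈ U) (l k i j : Fin n) :
    riemann g' l k i j x = riemann g l k i j x
      + (if l = j then 1 else 0) * (hess g Y k i x - pd k Y x * pd i Y x)
      - (if l = i then 1 else 0) * (hess g Y k j x - pd k Y x * pd j Y x)
      - g x j k * (covGrad g Y i l x - pd i Y x * grad g Y l x)
      + g x i k * (covGrad g Y j l x - pd j Y x * grad g Y l x)
      - (∑ m, pd m Y x * grad g Y m x) * ((if l = i then 1 else 0) * g x j k
        - (if l = j then 1 else 0) * g x i k) := by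
  have d : ∀ {f : Coord n → ℝ}, ContDiffOn ℝ ∞ f U → DifferentiableAt ℝ f x :=
    fun hf => differentiableAt_of_smooth hU hf hx
  have dc : ∀ i j k : Fin n, pd i (christoffel g' l j k) x = pd i (christoffel g l j k) x
      + (if l = j then 1 else 0) * pd i (pd k Y) x + (if l = k then 1 else 0) * pd i (pd j Y) x
      - (pd i (fun y => g y j k) x * grad g Y l x + g x j k * pd i (grad g Y l) x) := by
    intro i j k
    have d₁ := d (hg.smooth_christoffel hU l j k)
    have d₂ := d (smooth_pd hU hY k)
    have d₃ := d (smooth_pd hU hY j)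
    have d₄ := d (hg.smooth j k)
    have d₅ := d (hg.smooth_grad hU hY l)
    rw [pd_congr hU (fun y hy => conformal_christoffel hU hg hY h hy l j k) hx,
      pd_sub i ((d₁.fun_add (d₂.const_mul _)).fun_add (d₃.const_mul _)) (d₄.fun_mul d₅),
      pd_add i (d₁.fun_add (d₂.const_mul _)) (d₃.const_mul _), pd_add i d₁ (d₂.const_mul _),
      pd_const_mul i _ d₂, pd_const_mul i _ d₃, pd_mul i d₄ d₅]
  have lg : ∀ i, ∑ m, g x i m * grad g Y m x = pd i Y x := hg.lower_grad hx
  simp only [riemann, dc, Finset.sum_sub_distrib, conformal_christoffel hU hg hY h hx,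
    sum_conformal_product (fun a b c => christoffel g a b c x) (g x) (fun a => pd a Y x)
      (fun a => grad g Y a x), lg]
  simp only [hess, covGrad, hg.pd_metric hU hx, Finset.sum_add_distrib]
  rw [hg.christoffel_symm hU hx l j i, pd_comm hU hY hx j i, hg.symm x hx j i]
  simp only [hg.christoffel_symm hU hx _ j i, hg.christoffel_symm hU hx _ k]
  have c₁ : ∀ i j : Fin n, ∑ m, christoffel g m i k x * g x j m =
      ∑ m, g x j m * christoffel g m i k x :=
    fun i j => Finset.sum_congr rfl fun m _ => mul_comm _ _
  have c₂ : ∀ j : Fin n, ∑ m, christoffel g m j k x * pd m Y x =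
      ∑ m, pd m Y x * christoffel g m j k x :=
    fun j => Finset.sum_congr rfl fun m _ => mul_comm _ _
  simp only [c₁, c₂]
  ring

/-- If `g` and `e^{2Y} g` both have constant curvature, then `∇²Y - dY ⊗ dY` is pure trace. -/
theorem hess_eq_of_hasConstantCurvature (hn : 3 ≤ n) (hU : IsOpen U) (hg : IsMetric U g)
    (hY : ContDiffOn ℝ ∞ Y U) (h : ∀ x ∈ U, g' x = Real.exp (2 * Y x) • g x)
    (hc : HasConstantCurvature U g) (hc' : HasConstantCurvature U g') (hx : x ∈ U) :
    ∃ c : ℝ, ∀ i j, hess g Y i j x = pd i Y x * pd j Y x + c * g x i j := by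
  obtain ⟨κ, hκ⟩ := hc
  obtain ⟨κ', hκ'⟩ := hc'
  set N := ∑ m, pd m Y x * grad g Y m x
  set c₀ := κ' * Real.exp (2 * Y x) - κ + N
  set q := ∑ l, (covGrad g Y l l x - pd l Y x * grad g Y l x)
  have hn' : (2 : ℝ) - n ≠ 0 := by
    have : (3 : ℝ) ≤ n := by exact_mod_cast hn
    linarith
  refine ⟨(c₀ * (n - 1) + q) / (2 - n), fun k j => ?_⟩
  -- The curvature change with `i = l`, still unsummed. Both curvatures are multiples of the same
  -- expression in `g`, so the right-hand side is one too. Summing over `l` is the Ricci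
  -- contraction; it leaves `(2 - n)` times `∇²Y - dY ⊗ dY` and multiples of `g`, whence the
  -- denominator of the witness.
  have key : ∀ l, (if l = j then 1 else 0) * (hess g Y k l x - pd k Y x * pd l Y x)
      - (hess g Y k j x - pd k Y x * pd j Y x)
      - g x j k * (covGrad g Y l l x - pd l Y x * grad g Y l x)
      + g x l k * (covGrad g Y j l x - pd j Y x * grad g Y l x) =
      c₀ * (g x j k - (if l = j then 1 else 0) * g x l k) := by
    intro l
    have := conformal_riemann hU hg hY h hx l k l j
    rw [hκ x hx, hκ' x hx, h x hx] at this
    simp only [Matrix.smul_apply, smul_eq_mul, if_true] at this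
    simp only [c₀, N]
    linear_combination -this
  have sum := Finset.sum_congr (rfl : (Finset.univ : Finset (Fin n)) = _) fun l _ => key l
  have low : ∑ l, g x l k * (covGrad g Y j l x - pd j Y x * grad g Y l x) =
      hess g Y k j x - pd j Y x * pd k Y x := by
    simp only [mul_sub, Finset.sum_sub_distrib]
    rw [← hg.lower_covGrad hU hY hx, ← hg.lower_grad (f := Y) hx k, Finset.mul_sum]
    congr 1 <;> refine Finset.sum_congr rfl fun l _ => ?_
    · rw [hg.symm x hx l k]
    · rw [hg.symm x hx l k]; ring
  simp only [Finset.sum_add_distrib, Finset.sum_sub_distrib, ite_mul, one_mul, zero_mul,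
    Finset.sum_ite_eq', Finset.mem_univ, if_true, ← Finset.mul_sum, low, Finset.sum_const,
    Finset.card_univ, Fintype.card_fin, nsmul_eq_mul] at sum
  rw [← sub_eq_iff_eq_add', hg.symm x hx k j, div_mul_eq_mul_div, eq_div_iff hn']
  simp only [q, Finset.sum_sub_distrib]
  linear_combination sum

/-- Needed so that `R` passes through the derivative in `d(R B) = R dB`. -/
theorem scalarCurvature_const (hg : IsMetric U g) (hc : HasConstantCurvature U g) :
    ∃ R : ℝ, ∀ x ∈ U, scalarCurvature g x = R := by
  obtain ⟨κ, hκ⟩ := hc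
  refine ⟨κ * (n - 1) * n, fun x hx => ?_⟩
  have ric : ∀ k j, ricci g k j x = κ * (n - 1) * g x j k := by
    intro k j
    simp only [ricci, hκ x hx, if_true, mul_sub, Finset.sum_sub_distrib, ite_mul, one_mul,
      zero_mul, mul_ite, mul_zero, Finset.sum_ite_eq', Finset.mem_univ, Finset.sum_const,
      Finset.card_univ, Fintype.card_fin, nsmul_eq_mul]
    ring
  have tr : ∀ k, ∑ j, (g x)⁻¹ k j * (κ * (n - 1) * g x j k) = κ * (n - 1) := by
    intro k
    have := hg.sum_inv_mul hx k k
    rw [if_pos rfl] at this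
    calc _ = κ * (n - 1) * ∑ j, (g x)⁻¹ k j * g x j k := by
          rw [Finset.mul_sum]; exact Finset.sum_congr rfl fun j _ => by ring
      _ = _ := by rw [this, mul_one]
  simp only [scalarCurvature, ric, tr]
  simp; ring

end Curvature

/-! ### Conformal covariance of the trace-free symmetrised third derivative. -/

section ThirdDerivative

variable {n : ℕ} {U : Set (Coord n)} {g g' : Coord n → Matrix (Fin n) (Fin n) ℝ}
  {Y f : Coord n → ℝ} {x : Coord n}

/-- Covariant derivative `∇ₖ Hᵢⱼ` of a tensor of type `(0, 2)`. -/
def cov (g : Coord n → Matrix (Fin n) (Fin n) ℝ) (H : Fin n → Fin n → Coord n → ℝ)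
    (i j k : Fin n) (x : Coord n) : ℝ :=
  pd k (H i j) x
    - ∑ l, (christoffel g l k i x * H l j x + christoffel g l k j x * H i l x)

theorem third_eq_cov (f : Coord n → ℝ) (i j k : Fin n) :
    third g f i j k x = cov g (hess g f) i j k x := rfl

theorem cov_congr (hU : IsOpen U) {H H' : Fin n → Fin n → Coord n → ℝ}
    (h : ∀ i j, ∀ y ∈ U, H i j y = H' i j y) (hx : x ∈ U) (i j k : Fin n) :
    cov g H i j k x = cov g H' i j k x := by
  simp only [cov, pd_congr hU (h i j) hx, h _ _ x hx]

theorem cov_add {H H' : Fin n → Fin n → Coord n → ℝ} {i j : Fin n} (k : Fin n)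
    (h : DifferentiableAt ℝ (H i j) x) (h' : DifferentiableAt ℝ (H' i j) x) :
    cov g (fun i j y => H i j y + H' i j y) i j k x = cov g H i j k x + cov g H' i j k x := by
  simp only [cov]
  rw [pd_add k h h']
  simp only [mul_add, Finset.sum_add_distrib]
  ring

theorem cov_smul {s : Coord n → ℝ} {H : Fin n → Fin n → Coord n → ℝ} {i j : Fin n} (k : Fin n)
    (hs : DifferentiableAt ℝ s x) (h : DifferentiableAt ℝ (H i j) x) :
    cov g (fun i j y => s y * H i j y) i j k x = pd k s x * H i j x + s x * cov g H i j k x := by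
  simp only [cov]
  rw [pd_mul k hs h]
  simp only [mul_sub, Finset.mul_sum]
  have : ∀ l, christoffel g l k i x * (s x * H l j x) + christoffel g l k j x * (s x * H i l x) =
    s x * (christoffel g l k i x * H l j x + christoffel g l k j x * H i l x) := fun l => by ring
  simp only [this]
  ring

theorem cov_pd_mul_pd (hU : IsOpen U) (hg : IsMetric U g) {f₁ f₂ : Coord n → ℝ}
    (h₁ : ContDiffOn ℝ ∞ f₁ U) (h₂ : ContDiffOn ℝ ∞ f₂ U) (hx : x ∈ U) (i j k : Fin n) :
    cov g (fun i j y => pd i f₁ y * pd j f₂ y) i j k x =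
      hess g f₁ i k x * pd j f₂ x + pd i f₁ x * hess g f₂ j k x := by
  simp only [cov, hess]
  rw [pd_mul k (differentiableAt_of_smooth hU (smooth_pd hU h₁ i) hx)
    (differentiableAt_of_smooth hU (smooth_pd hU h₂ j) hx)]
  simp only [sub_mul, mul_sub, Finset.sum_add_distrib, Finset.sum_mul, Finset.mul_sum,
    hg.christoffel_symm hU hx _ k]
  have : ∀ l, christoffel g l j k x * (pd i f₁ x * pd l f₂ x) =
    pd i f₁ x * (christoffel g l j k x * pd l f₂ x) := fun l => by ring
  simp only [this, mul_assoc]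
  ring

theorem cov_metric (hU : IsOpen U) (hg : IsMetric U g) (hx : x ∈ U) (i j k : Fin n) :
    cov g (fun i j y => g y i j) i j k x = 0 := by
  simp only [cov]
  rw [hg.pd_metric hU hx, sub_self]

theorem conformal_cov (hU : IsOpen U) (hg : IsMetric U g) (hY : ContDiffOn ℝ ∞ Y U)
    (h : ∀ x ∈ U, g' x = Real.exp (2 * Y x) • g x) (hx : x ∈ U)
    (H : Fin n → Fin n → Coord n → ℝ) (i j k : Fin n) :
    cov g' H i j k x = cov g H i j k x - pd i Y x * H k j x - pd j Y x * H i k x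
      - 2 * pd k Y x * H i j x + g x k i * ∑ l, grad g Y l x * H l j x
      + g x k j * ∑ l, grad g Y l x * H i l x := by
  simp only [cov, conformal_christoffel hU hg hY h hx, sub_mul, add_mul,
    Finset.sum_add_distrib, Finset.sum_sub_distrib, ite_mul, one_mul, zero_mul,
    Finset.sum_ite_eq', Finset.mem_univ, if_true, Finset.mul_sum, mul_assoc]
  ring

/-- The trace of `hᵢⱼ Xₖ + hⱼₖ Xᵢ + hᵢₖ Xⱼ` is `(n + 2) X`, so the projection removes such a term
entirely. Trace and metric scale inversely, which leaves only the overall factor `w`. -/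
theorem traceFree3_conformal {h h' : Matrix (Fin n) (Fin n) ℝ} {w : ℝ} (hw : w ≠ 0)
    (hsymm : ∀ i j, h i j = h j i) (hdet : IsUnit h.det) (hh : h' = w • h)
    (hinv : h'⁻¹ = w⁻¹ • h⁻¹) {A A' : Fin n → Fin n → Fin n → ℝ} {X : Fin n → ℝ}
    (hA : ∀ i j k, A' i j k = w * (A i j k + (h i j * X k + h j k * X i + h i k * X j)))
    (i j k : Fin n) : traceFree3 h' A' i j k = w * traceFree3 h A i j k := by
  have inv : ∀ i j, ∑ k, h⁻¹ i k * h k j = if i = j then 1 else 0 := by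
    intro i j
    have := congrFun₂ (Matrix.nonsing_inv_mul h hdet) i j
    rwa [Matrix.mul_apply, Matrix.one_apply] at this
  have inv' : ∀ i j, ∑ k, h k i * h⁻¹ k j = if i = j then 1 else 0 := by
    intro i j
    have := congrFun₂ (Matrix.mul_nonsing_inv h hdet) i j
    rw [Matrix.mul_apply, Matrix.one_apply] at this
    rw [← this]
    exact Finset.sum_congr rfl fun k _ => by rw [hsymm]
  have tr : ∀ k, ∑ a, ∑ b, h'⁻¹ a b * A' a b k =
      ∑ a, ∑ b, h⁻¹ a b * A a b k + (n + 2) * X k := by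
    intro k
    have e : ∀ a b, h'⁻¹ a b * A' a b k = h⁻¹ a b * A a b k + (h⁻¹ a b * h b a * X k
        + h⁻¹ a b * h b k * X a + h a k * h⁻¹ a b * X b) := by
      intro a b
      rw [hinv, hA, hsymm a b, Matrix.smul_apply, smul_eq_mul]
      field_simp
    have s₁ : ∑ a, ∑ b, h⁻¹ a b * h b a * X k = n * X k := by
      simp [← Finset.sum_mul, inv]
    have s₂ : ∑ a, ∑ b, h⁻¹ a b * h b k * X a = X k := by
      simp [← Finset.sum_mul, inv]
    have s₃ : ∑ a, ∑ b, h a k * h⁻¹ a b * X b = X k := by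
      rw [Finset.sum_comm]
      simp [← Finset.sum_mul, inv']
    simp only [e, Finset.sum_add_distrib, s₁, s₂, s₃]
    ring
  have hn : (n : ℝ) + 2 ≠ 0 := by positivity
  simp only [traceFree3, tr]
  simp only [hA, hh, Matrix.smul_apply, smul_eq_mul]
  field_simp
  ring

/-- The cancellation behind weight two. Here `a = dY`, `B₁ = dB`, `B₂ = ∇²B`, `E` is the rescaled
Hessian of `e^{2Y} B` and `Z` its third derivative. After symmetrisation the terms of types `a B₂`,
`a a B₁` and `B a a a` coming from `∇E` are matched exactly by `- aᵢ Eₖⱼ - aⱼ Eᵢₖ`; only the third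
derivative `t` and terms containing `h` survive. -/
theorem symm3_conformal {h : Matrix (Fin n) (Fin n) ℝ} (hsymm : ∀ i j, h i j = h j i)
    {w B c ψ : ℝ} {a B₁ ψ₁ β : Fin n → ℝ} {B₂ : Fin n → Fin n → ℝ}
    (hB₂ : ∀ i j, B₂ i j = B₂ j i) {E : Fin n → Fin n → ℝ} (hE : ∀ i j, E i j =
      B₂ i j + a i * B₁ j + B₁ i * a j + 2 * B * (a i * a j) + ψ * h i j)
    {t Z : Fin n → Fin n → Fin n → ℝ}
    (hZ : ∀ i j k, Z i j k = w * (t i j k + ((a i * a k + c * h i k) * B₁ j + a i * B₂ j k)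
      + (B₂ i k * a j + B₁ i * (a j * a k + c * h j k)) + 2 * B₁ k * (a i * a j)
      + 2 * B * ((a i * a k + c * h i k) * a j + a i * (a j * a k + c * h j k))
      + ψ₁ k * h i j - a i * E k j - a j * E i k + h k i * β j + h k j * β i)) (i j k : Fin n) :
    symm3 Z i j k = w * (symm3 t i j k
      + (h i j * (4 * c * B₁ k + 8 * B * c * a k + 2 * ψ₁ k + 4 * β k - 4 * ψ * a k)
      + h j k * (4 * c * B₁ i + 8 * B * c * a i + 2 * ψ₁ i + 4 * β i - 4 * ψ * a i)
      + h i k * (4 * c * B₁ j + 8 * B * c * a j + 2 * ψ₁ j + 4 * β j - 4 * ψ * a j))) := by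
  simp only [symm3, hZ, hE]
  rw [hsymm j i, hsymm k i, hsymm k j, hB₂ j i, hB₂ k i, hB₂ k j]
  ring

/-- Between metrics `g` and `e^{2Y} g` of constant curvature, the trace-free symmetrised third
derivative is conformally covariant on functions of weight two. -/
theorem thirdTF_conformal (hn : 3 ≤ n) (hU : IsOpen U) (hg : IsMetric U g)
    (hY : ContDiffOn ℝ ∞ Y U) (h : ∀ x ∈ U, g' x = Real.exp (2 * Y x) • g x)
    (hc : HasConstantCurvature U g) (hc' : HasConstantCurvature U g') {B : Coord n → ℝ}
    (hB : ContDiffOn ℝ ∞ B U) (hx : x ∈ U) (i j k : Fin n) :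
    thirdTF g' (fun y => Real.exp (2 * Y y) * B y) i j k x =
      Real.exp (2 * Y x) * thirdTF g B i j k x := by
  have hn0 : (n : ℝ) ≠ 0 := by
    have : n ≠ 0 := by omega
    exact_mod_cast this
  have d : ∀ {f : Coord n → ℝ}, ContDiffOn ℝ ∞ f U → ∀ {y}, y ∈ U → DifferentiableAt ℝ f y :=
    fun hf _ hy => differentiableAt_of_smooth hU hf hy
  have sw : ContDiffOn ℝ ∞ (fun y => Real.exp (2 * Y y)) U := (contDiffOn_const.mul hY).exp
  have pw : ∀ y ∈ U, ∀ i, pd i (fun y => Real.exp (2 * Y y)) y =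
      2 * (Real.exp (2 * Y y) * pd i Y y) := fun y hy i => by
    rw [pd_exp i ((d hY hy).const_mul 2), pd_const_mul i 2 (d hY hy)]; ring
  -- `lam` is the trace coefficient of `∇²Y - dY ⊗ dY`. It is written through the Laplacian to make
  -- its smoothness visible: `ψ`, the coefficient of `g` in the Hessian of `e^{2Y} B`, contains it
  -- and will be differentiated.
  let N : Coord n → ℝ := fun y => ∑ m, pd m Y y * grad g Y m y
  let lam : Coord n → ℝ := fun y => 1 / (n : ℝ) * (laplacian g Y y - N y)
  let ψ : Coord n → ℝ := fun y =>
    2 * lam y * B y + ∑ m, grad g Y m y * pd m B y + 2 * N y * B y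
  have sN : ContDiffOn ℝ ∞ N U :=
    ContDiffOn.sum fun m _ => (smooth_pd hU hY m).mul (hg.smooth_grad hU hY m)
  have slam : ContDiffOn ℝ ∞ lam U := contDiffOn_const.mul ((hg.smooth_laplacian hU hY).sub sN)
  have sψ : ContDiffOn ℝ ∞ ψ U := (((contDiffOn_const.mul slam).mul hB).add
    (ContDiffOn.sum fun m _ => (hg.smooth_grad hU hY m).mul (smooth_pd hU hB m))).add
    ((contDiffOn_const.mul sN).mul hB)
  have hess_Y : ∀ y ∈ U, ∀ i j, hess g Y i j y = pd i Y y * pd j Y y + lam y * g y i j := by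
    intro y hy
    obtain ⟨c, hcy⟩ := hess_eq_of_hasConstantCurvature hn hU hg hY h hc hc' hy
    -- The curvature lemma gives a coefficient at each point separately; taking the trace identifies
    -- it with the smooth function `lam`.
    have : lam y = c := by
      have e : laplacian g Y y = N y + c * n := by
        have e₁ : ∀ i j, (g y)⁻¹ i j * hess g Y i j y = pd i Y y * ((g y)⁻¹ i j * pd j Y y)
            + c * ((g y)⁻¹ i j * g y j i) := fun i j => by
          rw [hcy, hg.symm y hy i j]; ring
        simp only [laplacian, e₁, Finset.sum_add_distrib, ← Finset.mul_sum, hg.sum_inv_mul hy]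
        simp [N, grad]
      simp only [lam, e]
      field_simp
      ring
    rw [this]; exact hcy
  let E : Fin n → Fin n → Coord n → ℝ := fun i j y => hess g B i j y + pd i Y y * pd j B y
    + pd i B y * pd j Y y + 2 * B y * (pd i Y y * pd j Y y) + ψ y * g y i j
  have sE : ∀ i j, ContDiffOn ℝ ∞ (E i j) U := fun i j =>
    ((((hg.smooth_hess hU hB i j).add ((smooth_pd hU hY i).mul (smooth_pd hU hB j))).add
      ((smooth_pd hU hB i).mul (smooth_pd hU hY j))).add ((contDiffOn_const.mul hB).mul
      ((smooth_pd hU hY i).mul (smooth_pd hU hY j)))).add (sψ.mul (hg.smooth i j))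
  have hess_wB : ∀ i j, ∀ y ∈ U, hess g' (fun y => Real.exp (2 * Y y) * B y) i j y =
      Real.exp (2 * Y y) * E i j y := by
    intro i j y hy
    have p : ∀ i, pd i (fun y => Real.exp (2 * Y y) * B y) y =
        Real.exp (2 * Y y) * (pd i B y + 2 * (B y * pd i Y y)) := fun i => by
      rw [pd_mul i (d sw hy) (d hB hy), pw y hy]; ring
    rw [conformal_hess hU hg hY h hy, hess_mul hU sw hB hy, hess_exp hU hY hy]
    simp only [p, pw y hy, hess_Y y hy]
    have s : ∑ m, grad g Y m y * (Real.exp (2 * Y y) * (pd m B y + 2 * (B y * pd m Y y))) =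
        Real.exp (2 * Y y) * (∑ m, grad g Y m y * pd m B y + 2 * N y * B y) := by
      simp only [N, Finset.mul_sum, Finset.sum_mul, ← Finset.sum_add_distrib]
      exact Finset.sum_congr rfl fun m _ => by ring
    rw [s]
    simp only [E, ψ]
    ring
  have cov_E : ∀ i j k, cov g E i j k x = third g B i j k x
      + (hess g Y i k x * pd j B x + pd i Y x * hess g B j k x)
      + (hess g B i k x * pd j Y x + pd i B x * hess g Y j k x) + 2 * pd k B x *
        (pd i Y x * pd j Y x) + 2 * B x * (hess g Y i k x * pd j Y x + pd i Y x * hess g Y j k x)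
      + pd k ψ x * g x i j := by
    intro i j k
    have d₁ := d (hg.smooth_hess hU hB i j) hx
    have d₂ := (d (smooth_pd hU hY i) hx).fun_mul (d (smooth_pd hU hB j) hx)
    have d₃ := (d (smooth_pd hU hB i) hx).fun_mul (d (smooth_pd hU hY j) hx)
    have d₄ := (d (smooth_pd hU hY i) hx).fun_mul (d (smooth_pd hU hY j) hx)
    have dB := (d hB hx).const_mul 2
    have dg := d (hg.smooth i j) hx
    have dψ := d sψ hx
    have e : E = fun i j y => (((hess g B i j y + pd i Y y * pd j B y)
        + pd i B y * pd j Y y) + (2 * B y) * (pd i Y y * pd j Y y)) + ψ y * g y i j := rfl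
    rw [e, cov_add (H := fun i j y => hess g B i j y + pd i Y y * pd j B y
        + pd i B y * pd j Y y + 2 * B y * (pd i Y y * pd j Y y))
        (H' := fun i j y => ψ y * g y i j) k (((d₁.fun_add d₂).fun_add d₃).fun_add
        (dB.fun_mul d₄)) (dψ.fun_mul dg),
      cov_add (H := fun i j y => hess g B i j y + pd i Y y * pd j B y + pd i B y * pd j Y y)
        (H' := fun i j y => 2 * B y * (pd i Y y * pd j Y y)) k
        ((d₁.fun_add d₂).fun_add d₃) (dB.fun_mul d₄),
      cov_add (H := fun i j y => hess g B i j y + pd i Y y * pd j B y)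
        (H' := fun i j y => pd i B y * pd j Y y) k (d₁.fun_add d₂) d₃,
      cov_add (H := hess g B) (H' := fun i j y => pd i Y y * pd j B y) k d₁ d₂,
      cov_smul (s := ψ) (H := fun i j y => g y i j) k dψ dg,
      cov_smul (s := fun y => 2 * B y) (H := fun i j y => pd i Y y * pd j Y y) k dB d₄,
      cov_pd_mul_pd hU hg hY hB hx, cov_pd_mul_pd hU hg hB hY hx, cov_pd_mul_pd hU hg hY hY hx,
      cov_metric hU hg hx, pd_const_mul k 2 (d hB hx), third_eq_cov]
    ring
  have E_symm : ∀ i j, E i j x = E j i x := fun i j => by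
    simp only [E]
    rw [hg.hess_symm hU hB hx i j, hg.symm x hx i j]; ring
  -- The term `2 Yₖ E` from differentiating `e^{2Y}` cancels the `-2 Yₖ` term of `conformal_cov`.
  have third_wB : ∀ i j k, third g' (fun y => Real.exp (2 * Y y) * B y) i j k x =
      Real.exp (2 * Y x) * (third g B i j k x
      + ((pd i Y x * pd k Y x + lam x * g x i k) * pd j B x + pd i Y x * hess g B j k x)
      + (hess g B i k x * pd j Y x + pd i B x * (pd j Y x * pd k Y x + lam x * g x j k))
      + 2 * pd k B x * (pd i Y x * pd j Y x)
      + 2 * B x * ((pd i Y x * pd k Y x + lam x * g x i k) * pd j Y x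
        + pd i Y x * (pd j Y x * pd k Y x + lam x * g x j k))
      + pd k ψ x * g x i j - pd i Y x * E k j x - pd j Y x * E i k x
      + g x k i * (∑ l, grad g Y l x * E l j x) + g x k j * (∑ l, grad g Y l x * E l i x)) := by
    intro i j k
    have s : ∀ j, ∑ l, grad g Y l x * (Real.exp (2 * Y x) * E l j x) =
        Real.exp (2 * Y x) * ∑ l, grad g Y l x * E l j x := fun j => by
      rw [Finset.mul_sum]; exact Finset.sum_congr rfl fun l _ => by ring
    rw [third_eq_cov, cov_congr hU hess_wB hx, conformal_cov hU hg hY h hx,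
      cov_smul (s := fun y => Real.exp (2 * Y y)) (H := E) k (d sw hx) (d (sE i j) hx), cov_E,
      pw x hx]
    simp only [E_symm i, s, hess_Y x hx]
    rw [E_symm j i, E_symm k i]
    ring
  have hw := (Real.exp_pos (2 * Y x)).ne'
  simp only [thirdTF]
  rw [traceFree3_conformal hw (hg.symm x hx) (hg.isUnit_det hx) (h x hx) (conformal_inv hg hx h)
    (symm3_conformal (hg.symm x hx) (hg.hess_symm hU hB hx) (fun i j => rfl) third_wB)]
  ring

end ThirdDerivative

/-! ### Unique continuation for closed linear first-order systems. -/

section Domination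

variable {n : ℕ} {U : Set (Coord n)} {N f f₁ f₂ : Coord n → ℝ}

/-- `f` is bounded on `U` by a continuous multiple of `N`. -/
def IsDominated (U : Set (Coord n)) (N f : Coord n → ℝ) : Prop :=
  ∃ C : Coord n → ℝ, ContinuousOn C U ∧ ∀ x ∈ U, |f x| ≤ C x * N x

theorem IsDominated.of_le (h : ∀ x ∈ U, |f x| ≤ N x) : IsDominated U N f :=
  ⟨fun _ => 1, continuousOn_const, fun x hx => by simpa using h x hx⟩

theorem IsDominated.congr (h : IsDominated U N f₁) (e : ∀ x ∈ U, f₂ x = f₁ x) :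
    IsDominated U N f₂ := by
  obtain ⟨C, hC, hb⟩ := h
  exact ⟨C, hC, fun x hx => by rw [e x hx]; exact hb x hx⟩

theorem IsDominated.add (h₁ : IsDominated U N f₁) (h₂ : IsDominated U N f₂) :
    IsDominated U N (fun x => f₁ x + f₂ x) := by
  obtain ⟨C₁, hC₁, hb₁⟩ := h₁
  obtain ⟨C₂, hC₂, hb₂⟩ := h₂
  refine ⟨fun x => C₁ x + C₂ x, hC₁.add hC₂, fun x hx => (abs_add_le _ _).trans ?_⟩
  rw [add_mul]
  exact add_le_add (hb₁ x hx) (hb₂ x hx)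

theorem IsDominated.mul_left {k : Coord n → ℝ} (hk : ContinuousOn k U)
    (h : IsDominated U N f) : IsDominated U N (fun x => k x * f x) := by
  obtain ⟨C, hC, hb⟩ := h
  refine ⟨fun x => |k x| * C x, hk.abs.mul hC, fun x hx => ?_⟩
  rw [abs_mul, mul_assoc]
  exact mul_le_mul_of_nonneg_left (hb x hx) (abs_nonneg _)

theorem IsDominated.sub (h₁ : IsDominated U N f₁) (h₂ : IsDominated U N f₂) :
    IsDominated U N (fun x => f₁ x - f₂ x) :=
  (h₁.add (h₂.mul_left (k := fun _ => -1) continuousOn_const)).congr fun x _ => by ring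

theorem IsDominated.sum {ι : Type*} {s : Finset ι} {F : ι → Coord n → ℝ}
    (h : ∀ a, IsDominated U N (F a)) : IsDominated U N (fun x => ∑ a ∈ s, F a x) := by
  choose C hC hb using h
  refine ⟨fun x => ∑ a ∈ s, C a x, continuousOn_finsetSum _ fun a _ => hC a, fun x hx => ?_⟩
  rw [Finset.sum_mul]
  exact (Finset.abs_sum_le_sum_abs _ _).trans (Finset.sum_le_sum fun a _ => hb a x hx)

/-- A Grönwall argument without integration: on a small closed ball the mean value inequality bounds
the maximum of `N` by half of itself. -/
theorem eventually_eq_zero_of_isDominated {ι : Type*} [Fintype ι] {F : ι → Coord n → ℝ}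
    (hU : IsOpen U) (hF : ∀ a, ContDiffOn ℝ ∞ (F a) U)
    (hd : ∀ a i, IsDominated U (fun x => ∑ b, |F b x|) (pd i (F a)))
    {x : Coord n} (hx : x ∈ U) (h0 : ∀ a, F a x = 0) :
    ∀ᶠ y in nhds x, ∀ a, F a y = 0 := by
  choose C hC hb using hd
  set N : Coord n → ℝ := fun x => ∑ b, |F b x| with hN
  set D : Coord n → ℝ := fun y => ∑ a, ∑ i, |C a i y|
  have hD : ContinuousOn D U :=
    continuousOn_finsetSum _ fun a _ => continuousOn_finsetSum _ fun i _ => (hC a i).abs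
  have hNc : ContinuousOn N U := continuousOn_finsetSum _ fun a _ => (hF a).continuousOn.abs
  have hN0 : ∀ y, 0 ≤ N y := fun y => Finset.sum_nonneg fun a _ => abs_nonneg _
  set M := D x + 1
  have hD0 : 0 ≤ D x :=
    Finset.sum_nonneg fun a _ => Finset.sum_nonneg fun i _ => abs_nonneg _
  have hM : 0 < M := by positivity
  have ev : ∀ᶠ y in nhds x, y ∈ U ∧ D y < M :=
    (hU.eventually_mem hx).and
      ((hD.continuousAt (hU.mem_nhds hx)).eventually_lt_const (by simp [M]))
  obtain ⟨r, hr, hball⟩ := Metric.eventually_nhds_iff.mp ev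
  set K : ℝ := Fintype.card ι * M + 1
  have hK : 0 < K := by positivity
  -- The first entry keeps the closed ball inside the region where `D < M`; the second makes `K * δ
  -- ≤ 1 / 2`, the contraction factor.
  set δ := min (r / 2) (1 / (2 * K))
  have hδ : 0 < δ := by positivity
  have hin : ∀ y ∈ Metric.closedBall x δ, y ∈ U ∧ D y < M := fun y hy =>
    hball (lt_of_le_of_lt (Metric.mem_closedBall.mp hy)
      (lt_of_le_of_lt (min_le_left _ _) (half_lt_self hr)))
  obtain ⟨z, hz, hmax⟩ := (isCompact_closedBall x δ).exists_isMaxOn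
    ⟨x, Metric.mem_closedBall_self hδ.le⟩ (hNc.mono fun y hy => (hin y hy).1)
  have bound : ∀ a, |F a z| ≤ M * N z * δ := by
    intro a
    have mv := (convex_closedBall x δ).norm_image_sub_le_of_norm_fderiv_le (𝕜 := ℝ)
      (f := F a) (C := M * N z)
      (fun y hy => differentiableAt_of_smooth hU (hF a) (hin y hy).1) (fun y hy => by
        calc ‖fderiv ℝ (F a) y‖ ≤ ∑ i, |pd i (F a) y| := norm_fderiv_le_sum_pd
          _ ≤ ∑ i, |C a i y| * N y := Finset.sum_le_sum fun i _ =>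
              (hb a i y (hin y hy).1).trans
                (mul_le_mul_of_nonneg_right (le_abs_self _) (hN0 y))
          _ = (∑ i, |C a i y|) * N y := by rw [Finset.sum_mul]
          _ ≤ D y * N y := mul_le_mul_of_nonneg_right
              (Finset.single_le_sum (f := fun a => ∑ i, |C a i y|)
                (fun a _ => Finset.sum_nonneg fun i _ => abs_nonneg _) (Finset.mem_univ a)) (hN0 y)
          _ ≤ M * N z := mul_le_mul (hin y hy).2.le (hmax hy) (hN0 y) hM.le)
      (Metric.mem_closedBall_self hδ.le) hz
    rw [h0 a, sub_zero, Real.norm_eq_abs] at mv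
    refine mv.trans (mul_le_mul_of_nonneg_left ?_ (mul_nonneg hM.le (hN0 z)))
    rw [← dist_eq_norm]
    exact hz
  have Nz : N z = 0 := by
    have h₁ : N z ≤ Fintype.card ι * (M * N z * δ) := by
      calc N z ≤ ∑ _a : ι, M * N z * δ := Finset.sum_le_sum fun a _ => bound a
        _ = _ := by simp
    have h₂ : K * δ ≤ 1 / 2 := by
      calc K * δ ≤ K * (1 / (2 * K)) := mul_le_mul_of_nonneg_left (min_le_right _ _) hK.le
        _ = 1 / 2 := by field_simp
    have h₃ : Fintype.card ι * (M * N z * δ) ≤ K * δ * N z := by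
      have := mul_nonneg hδ.le (hN0 z)
      simp only [K]
      linarith
    have h₄ := mul_le_mul_of_nonneg_right h₂ (hN0 z)
    have := hN0 z
    linarith
  filter_upwards [Metric.closedBall_mem_nhds x hδ] with y hy a
  have h₁ : N y ≤ 0 := Nz ▸ hmax hy
  have h₂ : |F a y| ≤ N y :=
    Finset.single_le_sum (f := fun b => |F b y|) (fun b _ => abs_nonneg _) (Finset.mem_univ a)
  exact abs_nonpos_iff.mp (h₂.trans h₁)

/-- A solution of a closed linear first-order system vanishes if it vanishes at one point. -/
theorem eq_zero_of_isDominated {ι : Type*} [Fintype ι] {F : ι → Coord n → ℝ}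
    (hU : IsOpen U) (hUc : IsConnected U) (hF : ∀ a, ContDiffOn ℝ ∞ (F a) U)
    (hd : ∀ a i, IsDominated U (fun x => ∑ b, |F b x|) (pd i (F a)))
    {x : Coord n} (hx : x ∈ U) (h0 : ∀ a, F a x = 0) : ∀ y ∈ U, ∀ a, F a y = 0 := by
  -- The common zero set is open by the local statement and relatively closed in `U` by continuity.
  have hsub : U ⊆ {y | y ∈ U ∧ ∀ a, F a y = 0} := by
    refine hUc.isPreconnected.subset_of_closure_inter_subset ?_ ⟨x, hx, hx, h0⟩ ?_
    · rw [isOpen_iff_mem_nhds]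
      rintro y ⟨hy, hy0⟩
      exact Filter.inter_mem (hU.mem_nhds hy)
        (eventually_eq_zero_of_isDominated hU hF hd hy hy0)
    · rintro y ⟨hyc, hy⟩
      refine ⟨hy, fun a => ?_⟩
      by_contra hne
      have ev := ((hF a).continuousOn.continuousAt (hU.mem_nhds hy)).eventually_ne hne
      obtain ⟨z, hz, _, hz0⟩ := mem_closure_iff_nhds.mp hyc _ ev
      exact hz (hz0 a)
  exact fun y hy => (hsub hy).2

end Domination

/-! ### Prolongation of the Wilczynski equation and the freedom of initial data. -/

section Potentials

variable {n : ℕ} {U : Set (Coord n)} {g : Coord n → Matrix (Fin n) (Fin n) ℝ}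
  {f f₁ f₂ : Coord n → ℝ} {x : Coord n}

theorem hess_congr (hU : IsOpen U) (h : ∀ y ∈ U, f₁ y = f₂ y) (hx : x ∈ U) (i j : Fin n) :
    hess g f₁ i j x = hess g f₂ i j x := by
  simp only [hess, pd_congr hU (fun y hy => pd_congr hU h hy i) hx j, pd_congr hU h hx]

theorem pd_linearCombination {ι : Type*} [Fintype ι] (hU : IsOpen U) {V : ι → Coord n → ℝ}
    (hV : ∀ a, ContDiffOn ℝ ∞ (V a) U) (hx : x ∈ U) (c : ι → ℝ) (i : Fin n) :
    pd i (fun y => ∑ a, c a * V a y) x = ∑ a, c a * pd i (V a) x := by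
  rw [pd_sum _ i fun a _ => (differentiableAt_of_smooth hU (hV a) hx).const_mul (c a)]
  exact Finset.sum_congr rfl fun a _ =>
    pd_const_mul i (c a) (differentiableAt_of_smooth hU (hV a) hx)

theorem hess_linearCombination {ι : Type*} [Fintype ι] (hU : IsOpen U) {V : ι → Coord n → ℝ}
    (hV : ∀ a, ContDiffOn ℝ ∞ (V a) U) (hx : x ∈ U) (c : ι → ℝ) (i j : Fin n) :
    hess g (fun y => ∑ a, c a * V a y) i j x = ∑ a, c a * hess g (V a) i j x := by
  simp only [hess]
  rw [pd_congr hU (fun y hy => pd_linearCombination hU hV hy c i) hx,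
    pd_linearCombination hU (fun a => smooth_pd hU (hV a) i) hx]
  simp only [pd_linearCombination hU hV hx, mul_sub, Finset.sum_sub_distrib, Finset.mul_sum]
  congr 1
  rw [Finset.sum_comm]
  exact Finset.sum_congr rfl fun a _ => Finset.sum_congr rfl fun k _ => by ring

theorem laplacian_linearCombination {ι : Type*} [Fintype ι] (hU : IsOpen U)
    {V : ι → Coord n → ℝ} (hV : ∀ a, ContDiffOn ℝ ∞ (V a) U) (hx : x ∈ U) (c : ι → ℝ) :
    laplacian g (fun y => ∑ a, c a * V a y) x = ∑ a, c a * laplacian g (V a) x := by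
  simp only [laplacian, hess_linearCombination hU hV hx, Finset.mul_sum]
  symm
  rw [Finset.sum_comm]
  refine Finset.sum_congr rfl fun i _ => ?_
  rw [Finset.sum_comm]
  exact Finset.sum_congr rfl fun j _ => Finset.sum_congr rfl fun a _ => by ring

theorem smooth_linearCombination {ι : Type*} [Fintype ι] {V : ι → Coord n → ℝ}
    (hV : ∀ a, ContDiffOn ℝ ∞ (V a) U) (c : ι → ℝ) :
    ContDiffOn ℝ ∞ (fun y => ∑ a, c a * V a y) U :=
  ContDiffOn.sum fun a _ => contDiffOn_const.mul (hV a)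

/-- The Wilczynski equation holds for linear combinations of the potentials. -/
theorem IsStructureTensors.linearCombination {ι : Type} [Fintype ι] (hU : IsOpen U)
    {V : ι → Coord n → ℝ} (hV : ∀ a, ContDiffOn ℝ ∞ (V a) U)
    {T : Coord n → Fin n → Fin n → Fin n → ℝ} {τ : Coord n → Fin n → Fin n → ℝ}
    (hT : IsStructureTensors U g V T τ) (c : ι → ℝ) :
    IsStructureTensors U g (fun (_ : Unit) y => ∑ a, c a * V a y) T τ := by
  refine ⟨hT.1, hT.2, hT.3, hT.4, hT.5, hT.6, fun _ x hx i j => ?_⟩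
  rw [hess_linearCombination hU hV hx, laplacian_linearCombination hU hV hx]
  simp only [pd_linearCombination hU hV hx, hT.wilczynski _ x hx i j, Finset.mul_sum, mul_add,
    Finset.sum_add_distrib]
  rw [Finset.sum_comm]
  congr 1
  · congr 1
    · exact Finset.sum_congr rfl fun m _ => Finset.sum_congr rfl fun a _ => by ring
    · exact Finset.sum_congr rfl fun a _ => by ring
  · exact Finset.sum_congr rfl fun a _ => by ring

/-- The quantities `V`, `ΔV`, `∂ₘV`, which satisfy a closed system for a potential `V`. -/
def jet (g : Coord n → Matrix (Fin n) (Fin n) ℝ) (V : Coord n → ℝ) :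
    Option (Option (Fin n)) → Coord n → ℝ
  | none => V
  | some none => laplacian g V
  | some (some m) => pd m V

theorem IsMetric.smooth_jet (hU : IsOpen U) (hg : IsMetric U g) {V : Coord n → ℝ}
    (hV : ContDiffOn ℝ ∞ V U) : ∀ a, ContDiffOn ℝ ∞ (jet g V a) U
  | none => hV
  | some none => hg.smooth_laplacian hU hV
  | some (some m) => smooth_pd hU hV m

theorem isDominated_jet {V : Coord n → ℝ} (a : Option (Option (Fin n))) :
    IsDominated U (fun x => ∑ b, |jet g V b x|) (jet g V a) :=
  .of_le fun x _ => Finset.single_le_sum (f := fun b => |jet g V b x|)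
    (fun _ _ => abs_nonneg _) (Finset.mem_univ a)

/-- The Wilczynski equation expresses second derivatives through the jet. Only the gradient of the
Laplacian is missing; it comes from the symmetry of third derivatives, and so the system closes. -/
theorem isDominated_pd_jet (hn : 2 ≤ n) (hU : IsOpen U) (hg : IsMetric U g) {ι : Type}
    {V : ι → Coord n → ℝ} {T : Coord n → Fin n → Fin n → Fin n → ℝ}
    {τ : Coord n → Fin n → Fin n → ℝ} (hT : IsStructureTensors U g V T τ) (v : ι)
    (hV : ContDiffOn ℝ ∞ (V v) U) (a : Option (Option (Fin n))) (k : Fin n) :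
    IsDominated U (fun x => ∑ b, |jet g (V v) b x|) (pd k (jet g (V v) a)) := by
  have dV : IsDominated U _ (V v) := isDominated_jet (g := g) none
  have dL : IsDominated U _ (laplacian g (V v)) := isDominated_jet (g := g) (some none)
  have dP : ∀ m, IsDominated U _ (pd m (V v)) := fun m => isDominated_jet (g := g) (some (some m))
  set N : Coord n → ℝ := fun x => ∑ b, |jet g (V v) b x|
  set W := V v
  set L := laplacian g W
  have sL : ContDiffOn ℝ ∞ L U := hg.smooth_laplacian hU hV
  let Θ : Fin n → Fin n → Fin n → Coord n → ℝ := fun i j m x => T x i j m + christoffel g m i j x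
  have sΘ : ∀ i j m, ContDiffOn ℝ ∞ (Θ i j m) U := fun i j m =>
    (hT.smooth_T i j m).add (hg.smooth_christoffel hU m i j)
  have eq₂ : ∀ i j, ∀ y ∈ U, pd j (pd i W) y =
      (∑ m, Θ i j m y * pd m W y) + (1 / (n : ℝ)) * (g y i j * L y) + τ y i j * W y := by
    intro i j y hy
    have := hT.wilczynski v y hy i j
    simp only [hess] at this
    simp only [Θ, add_mul, Finset.sum_add_distrib]
    linear_combination this
  have dP₂ : ∀ i j, IsDominated U N (pd j (pd i W)) := fun i j =>
    (((IsDominated.sum fun m => (dP m).mul_left (sΘ i j m).continuousOn).add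
      ((dL.mul_left (hg.smooth i j).continuousOn).mul_left continuousOn_const)).add
      (dV.mul_left (hT.smooth_τ i j).continuousOn)).congr (eq₂ i j)
  -- The derivative of the right-hand side of `eq₂` without the term in the gradient of `L`; it
  -- involves no derivative of `W` beyond the second and `L` itself.
  let Q : Fin n → Fin n → Fin n → Coord n → ℝ := fun i j k y =>
    ∑ m, (pd k (Θ i j m) y * pd m W y + Θ i j m y * pd k (pd m W) y)
      + (1 / (n : ℝ)) * (pd k (fun y => g y i j) y * L y)
      + (pd k (fun y => τ y i j) y * W y + τ y i j * pd k W y)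
  have dQ : ∀ i j k, IsDominated U N (Q i j k) := fun i j k =>
    ((IsDominated.sum fun m => ((dP m).mul_left (smooth_pd hU (sΘ i j m) k).continuousOn).add
      ((dP₂ m k).mul_left (sΘ i j m).continuousOn)).add
      ((dL.mul_left (smooth_pd hU (hg.smooth i j) k).continuousOn).mul_left
        continuousOn_const)).add
      ((dV.mul_left (smooth_pd hU (hT.smooth_τ i j) k).continuousOn).add
      ((dP k).mul_left (hT.smooth_τ i j).continuousOn))
  have eq₃ : ∀ i j k, ∀ y ∈ U, pd k (pd j (pd i W)) y =
      Q i j k y + (1 / (n : ℝ)) * (g y i j * pd k L y) := by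
    intro i j k y hy
    have d : ∀ {f : Coord n → ℝ}, ContDiffOn ℝ ∞ f U → DifferentiableAt ℝ f y :=
      fun hf => differentiableAt_of_smooth hU hf hy
    have d₁ : ∀ m ∈ (Finset.univ : Finset (Fin n)),
        DifferentiableAt ℝ (fun y => Θ i j m y * pd m W y) y := fun m _ =>
      (d (sΘ i j m)).fun_mul (d (smooth_pd hU hV m))
    have d₂ := (d (hg.smooth i j)).fun_mul (d sL)
    have d₃ := (d (hT.smooth_τ i j)).fun_mul (d hV)
    have d₁' := DifferentiableAt.fun_sum d₁
    rw [pd_congr hU (eq₂ i j) hy, pd_add k (d₁'.fun_add (d₂.const_mul _)) d₃,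
      pd_add k d₁' (d₂.const_mul _), pd_const_mul k _ d₂, pd_mul k (d (hg.smooth i j)) (d sL),
      pd_mul k (d (hT.smooth_τ i j)) (d hV), pd_sum _ k d₁]
    simp only [fun m => pd_mul k (d (sΘ i j m)) (d (smooth_pd hU hV m)), Q]
    ring
  have hn0 : (n : ℝ) ≠ 0 := by
    have : n ≠ 0 := by omega
    exact_mod_cast this
  have hn1 : (n : ℝ) - 1 ≠ 0 := by
    have : (2 : ℝ) ≤ n := by exact_mod_cast hn
    linarith
  -- Exchanging `j` and `k` in `eq₃` gives `gᵢⱼ ∂ₖL - gᵢₖ ∂ⱼL = n (Qᵢₖⱼ - Qᵢⱼₖ)`. Contraction with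
  -- `gⁱʲ` turns the left-hand side into `(n - 1) ∂ₖL`.
  have eqL : ∀ k, ∀ y ∈ U, pd k L y = (n : ℝ) / (n - 1) *
      ∑ i, ∑ j, (g y)⁻¹ i j * (Q i k j y - Q i j k y) := by
    intro k y hy
    have e : ∀ i j, (g y)⁻¹ i j * (Q i k j y - Q i j k y) = 1 / (n : ℝ) *
        ((g y)⁻¹ i j * g y j i * pd k L y - (g y)⁻¹ i j * pd j L y * g y i k) := by
      intro i j
      have := eq₃ i j k y hy
      rw [pd_comm hU (smooth_pd hU hV i) hy k j, eq₃ i k j y hy] at this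
      rw [hg.symm y hy j i]
      linear_combination (g y)⁻¹ i j * this
    have s₂ : ∑ i, ∑ j, (g y)⁻¹ i j * pd j L y * g y i k = pd k L y := by
      rw [← hg.lower_grad (f := L) hy k]
      simp only [grad, ← Finset.sum_mul]
      exact Finset.sum_congr rfl fun i _ => by rw [hg.symm y hy k i]; ring
    simp only [e, ← Finset.mul_sum, Finset.sum_sub_distrib, s₂]
    simp only [← Finset.sum_mul, hg.sum_inv_mul hy]
    simp
    field_simp
  match a with
  | none => exact dP k
  | some (some m) => exact dP₂ m k
  | some none =>
    exact ((IsDominated.sum fun i => IsDominated.sum fun j => ((dQ i k j).sub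
      (dQ i j k)).mul_left (hg.smooth_inv i j).continuousOn).mul_left
        continuousOn_const).congr (eqL k)

/-- A potential may be prescribed freely by its value, gradient and Laplacian at one point. -/
theorem exists_linearCombination_jet_eq (hn : 2 ≤ n) (hU : IsOpen U) (hUc : IsConnected U)
    (hg : IsMetric U g) {V : Fin (n + 2) → Coord n → ℝ} (hV : ∀ a, ContDiffOn ℝ ∞ (V a) U)
    (hli : LinearIndependent ℝ (fun a => U.domRestrict (V a)))
    {T : Coord n → Fin n → Fin n → Fin n → ℝ} {τ : Coord n → Fin n → Fin n → ℝ}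
    (hT : IsStructureTensors U g V T τ) (hx : x ∈ U) (J : Option (Option (Fin n)) → ℝ) :
    ∃ c : Fin (n + 2) → ℝ, ∀ o, jet g (fun y => ∑ a, c a * V a y) o x = J o := by
  let Φ : (Fin (n + 2) → ℝ) →ₗ[ℝ] (Option (Option (Fin n)) → ℝ) :=
    Fintype.linearCombination ℝ fun a o => jet g (V a) o x
  have hΦ : ∀ c o, Φ c o = jet g (fun y => ∑ a, c a * V a y) o x := by
    intro c o
    simp only [Φ, Fintype.linearCombination_apply, Finset.sum_apply, Pi.smul_apply, smul_eq_mul]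
    match o with
    | none => rfl
    | some none => exact (laplacian_linearCombination hU hV hx c).symm
    | some (some m) => exact (pd_linearCombination hU hV hx c m).symm
  -- A combination with zero jet at `x` vanishes on `U` by unique continuation, hence is trivial by
  -- linear independence. Surjectivity then follows since both spaces have dimension `n + 2`.
  have inj : Function.Injective Φ := by
    rw [← LinearMap.ker_eq_bot, LinearMap.ker_eq_bot']
    intro c hc
    have sV := smooth_linearCombination hV c
    have zero := eq_zero_of_isDominated hU hUc (hg.smooth_jet hU sV)
      (isDominated_pd_jet hn hU hg (hT.linearCombination hU hV c) () sV) hx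
      (fun o => by rw [← hΦ, hc]; rfl)
    have : ∑ a, c a • U.domRestrict (V a) = 0 := by
      funext y
      simpa [jet] using zero y y.2 none
    funext a
    exact Fintype.linearIndependent_iff.mp hli c this a
  have surj := (LinearMap.injective_iff_surjective_of_finrank_eq_finrank
    (by simp)).mp inj
  obtain ⟨c, hc⟩ := surj J
  exact ⟨c, fun o => by rw [← hΦ, hc]⟩

end Potentials

/-! ### Transformation of structure tensors, and uniqueness of structure functions. -/

section StructureTensors

variable {n : ℕ} {U : Set (Coord n)} {g g' : Coord n → Matrix (Fin n) (Fin n) ℝ}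
  {Y f : Coord n → ℝ} {x : Coord n}

/-- The change of a structure tensor under `(g, V) ↦ (e^{2Y} g, e^{-2Y} V)`. -/
theorem conformal_structureTensor {S S' : NondegenerateSystem n U} (hn : 2 ≤ n) (hU : IsOpen U)
    (hUc : IsConnected U) (hY : ContDiffOn ℝ ∞ Y U)
    (h : ∀ x ∈ U, S'.g x = Real.exp (2 * Y x) • S.g x)
    (hV : ∀ a, U.domRestrict (fun x => Real.exp (-2 * Y x) * S.V a x) ∈
      Submodule.span ℝ (Set.range fun a => U.domRestrict (S'.V a)))
    {T T' : Coord n → Fin n → Fin n → Fin n → ℝ} {τ τ' : Coord n → Fin n → Fin n → ℝ}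
    (hT : IsStructureTensors U S.g S.V T τ) (hT' : IsStructureTensors U S'.g S'.V T' τ')
    (hx : x ∈ U) (i j k : Fin n) :
    T' x i j k = T x i j k - 3 * (pd i Y x * (if j = k then 1 else 0)
      + pd j Y x * (if i = k then 1 else 0) - 2 / (n : ℝ) * (S.g x i j * grad S.g Y k x)) := by
  have hg := S.isMetric
  have hn0 : (n : ℝ) ≠ 0 := by
    have : n ≠ 0 := by omega
    exact_mod_cast this
  have d : ∀ {f : Coord n → ℝ}, ContDiffOn ℝ ∞ f U → DifferentiableAt ℝ f x :=
    fun hf => differentiableAt_of_smooth hU hf hx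
  -- With `W = 0` and `dW = dxᵏ` at `x`, the `τ` term drops out and the sum over `m` reduces to
  -- `Tᵢⱼᵏ`.
  obtain ⟨c, hc⟩ := exists_linearCombination_jet_eq hn hU hUc hg S.smooth_V
    S.linearIndependent_V hT hx (fun o => if o = some (some k) then 1 else 0)
  set W : Coord n → ℝ := fun y => ∑ a, c a * S.V a y with hW
  have sW : ContDiffOn ℝ ∞ W U := smooth_linearCombination S.smooth_V c
  have W0 : W x = 0 := by simpa [jet] using hc none
  have W1 : ∀ m, pd m W x = if m = k then 1 else 0 := fun m => by
    simpa [jet] using hc (some (some m))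
  set w : Coord n → ℝ := fun y => Real.exp (-2 * Y y)
  have sw : ContDiffOn ℝ ∞ w U := (contDiffOn_const.mul hY).exp
  have w0 : w x ≠ 0 := (Real.exp_pos _).ne'
  have pw : ∀ i, pd i w x = -2 * (w x * pd i Y x) := fun i => by
    rw [pd_exp i ((d hY).const_mul _), pd_const_mul i _ (d hY)]; ring
  obtain ⟨c', hc'⟩ : ∃ c' : Fin (n + 2) → ℝ, ∀ y ∈ U, w y * W y = ∑ a, c' a * S'.V a y := by
    have mem : U.domRestrict (fun y => w y * W y) ∈
        Submodule.span ℝ (Set.range fun a => U.domRestrict (S'.V a)) := by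
      have e : U.domRestrict (fun y => w y * W y) =
          ∑ a, c a • U.domRestrict (fun y => w y * S.V a y) := by
        funext y
        simp only [hW, Set.domRestrict_apply, Finset.sum_apply, Pi.smul_apply, smul_eq_mul,
          Finset.mul_sum]
        exact Finset.sum_congr rfl fun a _ => by ring
      rw [e]
      exact Submodule.sum_mem _ fun a _ => Submodule.smul_mem _ _ (hV a)
    obtain ⟨c', hc'⟩ := (Submodule.mem_span_range_iff_exists_fun ℝ).mp mem
    refine ⟨c', fun y hy => ?_⟩
    have := congrFun hc' ⟨y, hy⟩
    simpa using this.symm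
  have pf : ∀ m, pd m (fun y => ∑ a, c' a * S'.V a y) x = w x * if m = k then 1 else 0 := by
    intro m
    rw [← pd_congr hU hc' hx, pd_mul m (d sw) (d sW), W0, W1]
    ring
  set L := laplacian S.g W x
  set L' := laplacian S'.g (fun y => ∑ a, c' a * S'.V a y) x
  have eqW : ∀ i j, hess S.g W i j x = T x i j k + 1 / (n : ℝ) * S.g x i j * L := by
    intro i j
    have := (hT.linearCombination hU S.smooth_V c).wilczynski () x hx i j
    change hess S.g W i j x = (∑ m, T x i j m * pd m W x) + _ + τ x i j * W x at this
    simpa [W0, W1] using this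
  -- The `3` is `2 + 1`: two from differentiating `e^{-2Y}` in the Hessian of the product, one from
  -- the change of connection. Both Laplacian terms are multiples of `g` and go into `s`.
  have main : ∃ s, ∀ i j, T' x i j k = T x i j k - 3 * (pd i Y x * (if j = k then 1 else 0)
      + pd j Y x * (if i = k then 1 else 0)) + s * S.g x i j := by
    refine ⟨1 / (n : ℝ) * L + ∑ m, grad S.g Y m x * pd m W x
      - 1 / (n : ℝ) * (Real.exp (2 * Y x) * (w x)⁻¹) * L', fun i j => ?_⟩
    have e₁ := (hT'.linearCombination hU S'.smooth_V c').wilczynski () x hx i j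
    simp only [pf, ← hc' x hx, W0, mul_zero, add_zero, mul_ite, mul_one, Finset.sum_ite_eq',
      Finset.mem_univ, if_true] at e₁
    have p : ∀ m, pd m (fun y => w y * W y) x = w x * pd m W x := fun m => by
      rw [pd_mul m (d sw) (d sW), W0]; ring
    rw [← hess_congr hU hc' hx, conformal_hess hU hg hY h hx, hess_mul hU sw sW hx, eqW, W0,
      pw, pw, h x hx] at e₁
    simp only [p, Matrix.smul_apply, smul_eq_mul] at e₁
    rw [show ∑ m, grad S.g Y m x * (w x * pd m W x) =
      w x * ∑ m, grad S.g Y m x * pd m W x by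
        rw [Finset.mul_sum]; exact Finset.sum_congr rfl fun m _ => by ring] at e₁
    rw [← W1 i, ← W1 j]
    apply mul_right_cancel₀ w0
    have wi : (w x)⁻¹ * w x = 1 := inv_mul_cancel₀ w0
    change _ = _ + _ * L' at e₁
    linear_combination -e₁ + 1 / (n : ℝ) * Real.exp (2 * Y x) * L' * S.g x i j * wi
  obtain ⟨s, hs⟩ := main
  have tr' : ∑ i, ∑ j, (S.g x)⁻¹ i j * T' x i j k = 0 := by
    have := hT'.trace_T x hx k
    rw [conformal_inv hg hx h] at this
    simp only [Matrix.smul_apply, smul_eq_mul, mul_assoc, ← Finset.mul_sum] at this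
    exact (mul_eq_zero.mp this).resolve_left (inv_ne_zero (Real.exp_pos _).ne')
  have t₁ : ∑ i, ∑ j, (S.g x)⁻¹ i j * (pd i Y x * (if j = k then 1 else 0)) =
      grad S.g Y k x := by
    simp only [mul_ite, mul_one, mul_zero, Finset.sum_ite_eq', Finset.mem_univ, if_true, grad]
    exact Finset.sum_congr rfl fun i _ => by rw [hg.inv_symm hx]
  have t₂ : ∑ i, ∑ j, (S.g x)⁻¹ i j * (pd j Y x * (if i = k then 1 else 0)) =
      grad S.g Y k x := by
    rw [Finset.sum_comm]
    simp [grad]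
  have t₃ : ∑ i, ∑ j, (S.g x)⁻¹ i j * S.g x i j = n := by
    calc _ = ∑ i, ∑ j, (S.g x)⁻¹ i j * S.g x j i := Finset.sum_congr rfl fun i _ =>
          Finset.sum_congr rfl fun j _ => by rw [hg.symm x hx i j]
      _ = n := by simp [hg.sum_inv_mul hx]
  -- Both structure tensors are trace-free, so the trace of `hs` reads `0 = -6 · gradᵏ Y + n s`.
  have hs0 : s = 6 / n * grad S.g Y k x := by
    have e : ∀ i j, (S.g x)⁻¹ i j * T' x i j k = (S.g x)⁻¹ i j * T x i j k
        - 3 * ((S.g x)⁻¹ i j * (pd i Y x * (if j = k then 1 else 0)))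
        - 3 * ((S.g x)⁻¹ i j * (pd j Y x * (if i = k then 1 else 0)))
        + s * ((S.g x)⁻¹ i j * S.g x i j) := fun i j => by rw [hs]; ring
    simp only [e, Finset.sum_add_distrib, Finset.sum_sub_distrib, ← Finset.mul_sum, t₁, t₂, t₃,
      hT.trace_T x hx k] at tr'
    field_simp
    linarith
  rw [hs, hs0]
  ring

theorem conformal_lower {S S' : NondegenerateSystem n U} (hn : 2 ≤ n) (hU : IsOpen U)
    (hUc : IsConnected U) (hY : ContDiffOn ℝ ∞ Y U)
    (h : ∀ x ∈ U, S'.g x = Real.exp (2 * Y x) • S.g x)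
    (hV : ∀ a, U.domRestrict (fun x => Real.exp (-2 * Y x) * S.V a x) ∈
      Submodule.span ℝ (Set.range fun a => U.domRestrict (S'.V a)))
    {T T' : Coord n → Fin n → Fin n → Fin n → ℝ} {τ τ' : Coord n → Fin n → Fin n → ℝ}
    (hT : IsStructureTensors U S.g S.V T τ) (hT' : IsStructureTensors U S'.g S'.V T' τ')
    (hx : x ∈ U) (i j k : Fin n) :
    lower S'.g T' i j k x = Real.exp (2 * Y x) * (lower S.g T i j k x
      - 3 * tracePart (S.g x) (fun l => pd l Y x) i j k) := by
  have hg := S.isMetric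
  have e : ∀ m, S'.g x k m * T' x i j m = Real.exp (2 * Y x) * (S.g x k m * T x i j m
      - 3 * (S.g x k m * (if j = m then 1 else 0) * pd i Y x
        + S.g x k m * (if i = m then 1 else 0) * pd j Y x
        - 2 / (n : ℝ) * S.g x i j * (S.g x k m * grad S.g Y m x))) := fun m => by
    rw [conformal_structureTensor hn hU hUc hY h hV hT hT' hx, h x hx, Matrix.smul_apply,
      smul_eq_mul]
    ring
  simp only [lower, e, ← Finset.mul_sum, Finset.sum_sub_distrib, Finset.sum_add_distrib,
    hg.lower_grad hx]
  simp only [mul_ite, mul_one, mul_zero, ite_mul, zero_mul, Finset.sum_ite_eq, Finset.mem_univ,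
    if_true, tracePart]
  rw [hg.symm x hx k i, hg.symm x hx k j]
  ring

theorem thirdTF_congr (hU : IsOpen U) {f₁ f₂ : Coord n → ℝ} (h : ∀ y ∈ U, f₁ y = f₂ y)
    (hx : x ∈ U) (i j k : Fin n) : thirdTF g f₁ i j k x = thirdTF g f₂ i j k x := by
  simp only [thirdTF, third_eq_cov,
    cov_congr hU (fun i j y hy => hess_congr (g := g) hU h hy i j) hx]

theorem thirdTF_sub (hU : IsOpen U) (hg : IsMetric U g) {f₁ f₂ : Coord n → ℝ}
    (h₁ : ContDiffOn ℝ ∞ f₁ U) (h₂ : ContDiffOn ℝ ∞ f₂ U) (hx : x ∈ U) (i j k : Fin n) :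
    thirdTF g (fun y => f₁ y - f₂ y) i j k x = thirdTF g f₁ i j k x - thirdTF g f₂ i j k x := by
  have d : ∀ {f : Coord n → ℝ}, ContDiffOn ℝ ∞ f U → ∀ {y}, y ∈ U → DifferentiableAt ℝ f y :=
    fun hf _ hy => differentiableAt_of_smooth hU hf hy
  have hess_sub : ∀ i j, ∀ y ∈ U, hess g (fun y => f₁ y - f₂ y) i j y =
      hess g f₁ i j y - hess g f₂ i j y := by
    intro i j y hy
    simp only [hess]
    rw [pd_congr hU (fun z hz => pd_sub i (d h₁ hz) (d h₂ hz)) hy,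
      pd_sub j (d (smooth_pd hU h₁ i) hy) (d (smooth_pd hU h₂ i) hy)]
    simp only [pd_sub _ (d h₁ hy) (d h₂ hy), mul_sub, Finset.sum_sub_distrib]
    ring
  have third_sub : ∀ i j k, third g (fun y => f₁ y - f₂ y) i j k x =
      third g f₁ i j k x - third g f₂ i j k x := by
    intro i j k
    simp only [third]
    rw [pd_congr hU (hess_sub i j) hx,
      pd_sub k (d (hg.smooth_hess hU h₁ i j) hx) (d (hg.smooth_hess hU h₂ i j) hx)]
    simp only [hess_sub _ _ x hx, mul_sub, Finset.sum_sub_distrib, Finset.sum_add_distrib]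
    ring
  have symm3_sub : symm3 (fun a b c => third g (fun y => f₁ y - f₂ y) a b c x) =
      fun i j k => symm3 (fun a b c => third g f₁ a b c x) i j k
        - symm3 (fun a b c => third g f₂ a b c x) i j k := by
    funext i j k
    simp only [symm3, third_sub]
    ring
  simp only [thirdTF, symm3_sub, traceFree3, mul_sub, Finset.sum_sub_distrib]
  ring

theorem IsMetric.trace_thirdTF (hg : IsMetric U g) (hx : x ∈ U) (f : Coord n → ℝ) (i : Fin n) :
    ∑ j, ∑ k, (g x)⁻¹ j k * thirdTF g f i j k x = 0 := by
  set A := symm3 (fun a b c => third g f a b c x)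
  set t : Fin n → ℝ := fun k => ∑ a, ∑ b, (g x)⁻¹ a b * A a b k
  have hn : (n : ℝ) + 2 ≠ 0 := by positivity
  have e : ∀ j k, (g x)⁻¹ j k * thirdTF g f i j k x = 1 / 6 * ((g x)⁻¹ j k * A j k i
      - 1 / ((n : ℝ) + 2) * (g x i j * ((g x)⁻¹ j k * t k) + (g x)⁻¹ j k * g x k j * t i
        + (g x)⁻¹ j k * g x k i * t j)) := by
    intro j k
    have : A i j k = A j k i := by simp only [A, symm3]; ring
    simp only [thirdTF, traceFree3]
    rw [← this, hg.symm x hx k j, hg.symm x hx k i]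
    simp only [t, A]
    ring
  simp only [e, ← Finset.mul_sum, Finset.sum_sub_distrib, Finset.sum_add_distrib,
    hg.sum_lower_raise hx]
  simp only [← Finset.sum_mul, hg.sum_inv_mul hx]
  simp
  change t i - _ = 0
  field_simp
  ring

/-- The contraction is over the last two indices, since that over the first two vanishes. The factor
`1 + n - 2/n = (n + 2)(n - 1)/n` is nonzero for `n ≥ 2`, so `X` can be recovered. -/
theorem IsMetric.trace_tracePart (hn : n ≠ 0) (hg : IsMetric U g) (hx : x ∈ U) (X : Fin n → ℝ)
    (i : Fin n) : ∑ j, ∑ k, (g x)⁻¹ j k * tracePart (g x) X i j k =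
      ((n : ℝ) + 2) * (n - 1) / n * X i := by
  have hn0 : (n : ℝ) ≠ 0 := by exact_mod_cast hn
  have e : ∀ j k, (g x)⁻¹ j k * tracePart (g x) X i j k =
      (g x)⁻¹ j k * g x k i * X j + (g x)⁻¹ j k * g x k j * X i
      - 2 / (n : ℝ) * (g x i j * ((g x)⁻¹ j k * X k)) := by
    intro j k
    simp only [tracePart]
    rw [hg.symm x hx k j, hg.symm x hx k i]
    ring
  simp only [e, ← Finset.mul_sum, Finset.sum_sub_distrib, Finset.sum_add_distrib,
    hg.sum_lower_raise hx]
  simp only [← Finset.sum_mul, hg.sum_inv_mul hx]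
  simp
  field_simp
  ring

/-- A structure tensor determines its structure functions up to gauge. -/
theorem IsStructurePair.unique (hn : 2 ≤ n) (hU : IsOpen U) (hUc : IsConnected U)
    (hg : IsMetric U g) {T : Coord n → Fin n → Fin n → Fin n → ℝ} {B₁ B₂ t₁ t₂ : Coord n → ℝ}
    (hB₁ : ContDiffOn ℝ ∞ B₁ U) (hB₂ : ContDiffOn ℝ ∞ B₂ U) (ht₁ : ContDiffOn ℝ ∞ t₁ U)
    (ht₂ : ContDiffOn ℝ ∞ t₂ U) (h₁ : IsStructurePair U g T B₁ t₁)
    (h₂ : IsStructurePair U g T B₂ t₂) :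
    IsGauge U g (fun x => B₁ x - B₂ x) ∧ ∃ c : ℝ, ∀ x ∈ U, t₁ x = t₂ x + c := by
  have hn0 : (n : ℝ) ≠ 0 := by
    have : n ≠ 0 := by omega
    exact_mod_cast this
  have hn1 : (n : ℝ) - 1 ≠ 0 := by
    have : (2 : ℝ) ≤ n := by exact_mod_cast hn
    linarith
  -- Contracting both representations of the same tensor removes the `thirdTF` parts and leaves the
  -- same nonzero multiple of each differential.
  have eqt : ∀ x ∈ U, ∀ i, pd i t₁ x = pd i t₂ x := by
    intro x hx i
    have e : ∑ j, ∑ k, (g x)⁻¹ j k * (thirdTF g B₁ i j k x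
        + tracePart (g x) (fun l => pd l t₁ x) i j k) = ∑ j, ∑ k, (g x)⁻¹ j k *
        (thirdTF g B₂ i j k x + tracePart (g x) (fun l => pd l t₂ x) i j k) := by
      simp only [← h₁ x hx, ← h₂ x hx]
    simp only [mul_add, Finset.sum_add_distrib, hg.trace_thirdTF hx,
      hg.trace_tracePart (by omega : n ≠ 0) hx, zero_add] at e
    have h0 : ((n : ℝ) + 2) * (n - 1) / n ≠ 0 :=
      div_ne_zero (mul_ne_zero (by positivity) hn1) hn0
    exact mul_left_cancel₀ h0 (by simpa only [mul_add, add_mul] using e)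
  refine ⟨fun x hx i j k => ?_, ?_⟩
  · have e := (h₁ x hx i j k).symm.trans (h₂ x hx i j k)
    simp only [eqt x hx] at e
    rw [thirdTF_sub hU hg hB₁ hB₂ hx]
    linarith
  · obtain ⟨c, hc⟩ := exists_const_of_pd_eq_zero hU hUc (ht₁.sub ht₂) fun x hx i => by
      rw [pd_sub i (differentiableAt_of_smooth hU ht₁ hx) (differentiableAt_of_smooth hU ht₂ hx),
        eqt x hx, sub_self]
    exact ⟨c, fun x hx => by linarith [hc x hx]⟩

theorem smooth_tbar (hU : IsOpen U) (hg : IsMetric U g) (hc : HasConstantCurvature U g)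
    {B : Coord n → ℝ} (hB : ContDiffOn ℝ ∞ B U) : ContDiffOn ℝ ∞ (tbar g B) U := by
  obtain ⟨R, hR⟩ := scalarCurvature_const hg hc
  refine (contDiffOn_const (c := 1 / ((n : ℝ) + 2))).mul ((hg.smooth_laplacian hU hB).add
    (ContDiffOn.mul (ContDiffOn.mul contDiffOn_const ?_) hB))
  exact (contDiffOn_const (c := R)).congr hR

/-- Constancy of `R` makes the covector in the trace part exact, with potential `tbar g B`. -/
theorem IsStructureFunction.isStructurePair (hU : IsOpen U) (hg : IsMetric U g)
    (hc : HasConstantCurvature U g) {T : Coord n → Fin n → Fin n → Fin n → ℝ} {B : Coord n → ℝ}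
    (hB : ContDiffOn ℝ ∞ B U) (h : IsStructureFunction U g T B) :
    IsStructurePair U g T B (tbar g B) := by
  obtain ⟨R, hR⟩ := scalarCurvature_const hg hc
  intro x hx i j k
  have dB := differentiableAt_of_smooth hU hB hx
  have dL := differentiableAt_of_smooth hU (hg.smooth_laplacian hU hB) hx
  have e : ∀ l, pd l (tbar g B) x = 1 / ((n : ℝ) + 2) * (pd l (laplacian g B) x +
      2 * ((n : ℝ) + 1) / ((n : ℝ) * ((n : ℝ) - 1)) * scalarCurvature g x * pd l B x) := by
    intro l
    rw [pd_congr hU (f₂ := fun y => 1 / ((n : ℝ) + 2) * (laplacian g B y +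
      2 * ((n : ℝ) + 1) / ((n : ℝ) * ((n : ℝ) - 1)) * R * B y))
      (fun y hy => by rw [tbar, hR y hy]) hx, pd_const_mul l _ (dL.fun_add (dB.const_mul _)),
      pd_add l dL (dB.const_mul _), pd_const_mul l _ dB, hR x hx]
  simp only [e]
  exact h x hx i j k

end StructureTensors

/-! ### Assembly of the transformation law. -/

/-- The conformal transformation of pairs of structure functions. -/
theorem ConformallyEquivalent.isStructurePair_iff {n : ℕ} {U : Set (Coord n)}
    {S S' : NondegenerateSystem n U} {Ω : Coord n → ℝ} (hn : 3 ≤ n) (hU : IsOpen U)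
    (hUc : IsConnected U) (hΩ : ConformallyEquivalent S S' Ω) (hc : HasConstantCurvature U S.g)
    (hc' : HasConstantCurvature U S'.g)
    {T T' : Coord n → Fin n → Fin n → Fin n → ℝ} {τ τ' : Coord n → Fin n → Fin n → ℝ}
    (hT : IsStructureTensors U S.g S.V T τ) (hT' : IsStructureTensors U S'.g S'.V T' τ')
    {B t : Coord n → ℝ} (hB : ContDiffOn ℝ ∞ B U) (ht : ContDiffOn ℝ ∞ t U) :
    IsStructurePair U S.g T B t ↔ IsStructurePair U S'.g T' (fun x => (Ω x) ^ 2 * B x)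
      (fun x => t x - 3 * Real.log |Ω x|) := by
  set Y : Coord n → ℝ := fun x => Real.log |Ω x|
  -- `Ω` may be negative; `Real.log` is even, so `Y` is also the logarithm of `Ω` itself.
  have hY : ContDiffOn ℝ ∞ Y U :=
    (hΩ.smooth.log hΩ.ne_zero).congr fun x _ => Real.log_abs (Ω x)
  have hexp : ∀ x ∈ U, Real.exp (2 * Y x) = (Ω x) ^ 2 := fun x hx => by
    rw [two_mul, Real.exp_add, Real.exp_log (abs_pos.mpr (hΩ.ne_zero x hx)), ← sq, sq_abs]
  have h : ∀ x ∈ U, S'.g x = Real.exp (2 * Y x) • S.g x := fun x hx => by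
    rw [hexp x hx, hΩ.metric x hx]
  have hV : ∀ a, U.domRestrict (fun x => Real.exp (-2 * Y x) * S.V a x) ∈
      Submodule.span ℝ (Set.range fun a => U.domRestrict (S'.V a)) := by
    intro a
    rw [hΩ.potentials]
    refine Submodule.subset_span ⟨a, ?_⟩
    funext y
    simp only [Set.domRestrict_apply, neg_mul, Real.exp_neg, hexp _ y.2]
  refine forall₂_congr fun x hx => forall₃_congr fun i j k => ?_
  have hw := (Real.exp_pos (2 * Y x)).ne'
  have htd := differentiableAt_of_smooth hU ht hx
  have hYd := differentiableAt_of_smooth hU hY hx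
  rw [conformal_lower (by omega) hU hUc hY h hV hT hT' hx,
    thirdTF_congr (g := S'.g) hU (f₁ := fun x => (Ω x) ^ 2 * B x)
      (f₂ := fun y => Real.exp (2 * Y y) * B y)
      (fun y hy => by rw [hexp y hy]) hx,
    thirdTF_conformal hn hU S.isMetric hY h hc hc' hB hx]
  -- The trace part is linear in the metric and in the covector, so `-3Y` in `t` yields exactly the
  -- extra term of `conformal_lower`, and the common factor `e^{2Y}` can be cancelled.
  have htr : tracePart (S'.g x) (fun l => pd l (fun x => t x - 3 * Real.log |Ω x|) x) i j k =
      Real.exp (2 * Y x) * (tracePart (S.g x) (fun l => pd l t x) i j k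
        - 3 * tracePart (S.g x) (fun l => pd l Y x) i j k) := by
    have p : ∀ l, pd l (fun x => t x - 3 * Real.log |Ω x|) x = pd l t x - 3 * pd l Y x :=
      fun l => by rw [pd_sub l htd (hYd.const_mul 3), pd_const_mul l 3 hYd]
    simp only [tracePart, p, h x hx, Matrix.smul_apply, smul_eq_mul]
    ring
  rw [htr, ← mul_add, mul_right_inj' hw]
  constructor <;> intro e <;> linarith

end Superintegrable

end

theorem mainTheorem7 {n : ℕ} (hn : 3 ≤ n) {U : Set (Superintegrable.Coord n)}
    (hU : IsOpen U) (hUc : IsConnected U)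
    (S S' : Superintegrable.NondegenerateSystem n U) (Ω : Superintegrable.Coord n → ℝ)
    (hΩ : Superintegrable.ConformallyEquivalent S S' Ω)
    (hc : Superintegrable.HasConstantCurvature U S.g)
    (hc' : Superintegrable.HasConstantCurvature U S'.g)
    (T T' : Superintegrable.Coord n → Fin n → Fin n → Fin n → ℝ)
    (τ τ' : Superintegrable.Coord n → Fin n → Fin n → ℝ)
    (hT : Superintegrable.IsStructureTensors U S.g S.V T τ)
    (hT' : Superintegrable.IsStructureTensors U S'.g S'.V T' τ') :
    -- `(B, t) ↦ (Ω² B, t - 3 ln |Ω|)` takes structure functions of the first system to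
    -- structure functions of the second one, and every pair of the second one arises so
    (∀ B t : Superintegrable.Coord n → ℝ, ContDiffOn ℝ ∞ B U → ContDiffOn ℝ ∞ t U →
      (Superintegrable.IsStructurePair U S.g T B t ↔
        Superintegrable.IsStructurePair U S'.g T' (fun x => (Ω x) ^ 2 * B x)
          (fun x => t x - 3 * Real.log |Ω x|))) ∧
    -- all pairs of structure functions of the second system are gauge equivalent to this one
    (∀ B t B' t' : Superintegrable.Coord n → ℝ, ContDiffOn ℝ ∞ B U → ContDiffOn ℝ ∞ t U →
      ContDiffOn ℝ ∞ B' U → ContDiffOn ℝ ∞ t' U →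
      Superintegrable.IsStructurePair U S.g T B t →
      Superintegrable.IsStructurePair U S'.g T' B' t' →
      Superintegrable.IsGauge U S'.g (fun x => B' x - (Ω x) ^ 2 * B x) ∧
      ∃ c : ℝ, ∀ x ∈ U, t' x = t x - 3 * Real.log |Ω x| + c) ∧
    -- the case of a structure function `B` alone, `t` being built from `B`
    (∀ B : Superintegrable.Coord n → ℝ, ContDiffOn ℝ ∞ B U →
      Superintegrable.IsStructureFunction U S.g T B →
      Superintegrable.IsStructurePair U S'.g T' (fun x => (Ω x) ^ 2 * B x)
        (fun x => Superintegrable.tbar S.g B x - 3 * Real.log |Ω x|) ∧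
      ∀ B' : Superintegrable.Coord n → ℝ, ContDiffOn ℝ ∞ B' U →
        Superintegrable.IsStructureFunction U S'.g T' B' →
        Superintegrable.IsGauge U S'.g (fun x => B' x - (Ω x) ^ 2 * B x) ∧
        ∃ c : ℝ, ∀ x ∈ U, Superintegrable.tbar S'.g B' x =
          Superintegrable.tbar S.g B x - 3 * Real.log |Ω x| + c) := by
  have hg := S.isMetric
  have hg' := S'.isMetric
  have hΩ2 : ContDiffOn ℝ ∞ (fun x => (Ω x) ^ 2) U := hΩ.smooth.pow 2
  have hlog : ContDiffOn ℝ ∞ (fun x => 3 * Real.log |Ω x|) U :=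
    contDiffOn_const.mul ((hΩ.smooth.log hΩ.ne_zero).congr fun x _ => Real.log_abs (Ω x))
  have iff := fun B t hB ht => hΩ.isStructurePair_iff hn hU hUc hc hc' hT hT' (B := B) (t := t)
    hB ht
  have uniq : ∀ B t B' t' : Superintegrable.Coord n → ℝ, ContDiffOn ℝ ∞ B U →
      ContDiffOn ℝ ∞ t U → ContDiffOn ℝ ∞ B' U → ContDiffOn ℝ ∞ t' U →
      Superintegrable.IsStructurePair U S.g T B t →
      Superintegrable.IsStructurePair U S'.g T' B' t' →
      Superintegrable.IsGauge U S'.g (fun x => B' x - (Ω x) ^ 2 * B x) ∧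
      ∃ c : ℝ, ∀ x ∈ U, t' x = t x - 3 * Real.log |Ω x| + c :=
    -- Uniqueness is applied for the second metric, comparing the given pair with the transported
    -- one.
    fun B t B' t' hB ht hB' ht' h h' => Superintegrable.IsStructurePair.unique (by omega) hU hUc
      hg' hB' (hΩ2.mul hB) ht' (ht.sub hlog) h' ((iff B t hB ht).mp h)
  refine ⟨iff, uniq, fun B hB h => ?_⟩
  have st := Superintegrable.smooth_tbar hU hg hc hB
  have hp := h.isStructurePair hU hg hc hB
  exact ⟨(iff _ _ hB st).mp hp, fun B' hB' h' => uniq _ _ _ _ hB st hB'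
    (Superintegrable.smooth_tbar hU hg' hc' hB') hp (h'.isStructurePair hU hg' hc' hB')⟩
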